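/- **Conventions.** Formulas are propositional formulas in $\land,\lor,\to,\neg$; "algebra" means Heyting algebra. A variety is the class of all algebras validating some set of formulas; $\vdash_{\mathcal V}A$ means that $A$ is valid in all algebras of $\mathcal V$, and $\mathrm{Log}(\mathcal V)=\{A:\ \vdash_{\mathcal V}A\}$ is the logic of $\mathcal V$. An intermediate logic is a set of formulas lying between intuitionistic and classical propositional logic and closed under modus ponens and substitution. $\mathbf Z$ is the Rieger–Nishimura ladder (the free algebra on one generator), $\mathbf Z_n$ is the $n$-element one-generated algebra, and $\mathbf A+\mathbf B$ is the concatenation ($\mathbf B$ is put on top of $\mathbf A$, and the top of $\mathbf A$ is glued to the bottom of $\mathbf B$). Let $\mathbf K=\mathbf Z+\mathbf Z_7+\mathbf Z_2$ be the Kuznetsov–Gerčiu algebra, and let $\mathcal{KG}$ be the variety defined by $$(p\to q)\lor(q\to r)\lor((q\to r)\to r)\lor(r\to(p\lor q)).$$ A formula is *pre-true* in an algebra if it is not valid in it, but is valid in all its proper subalgebras and all its proper homomorphic images. Given a variety $\mathcal V$, a formula $A(\bar p)$ and a valuation $\nu$ in an algebra $\mathbf A$, the pair $\langle A,\nu\rangle$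 *defines* $\mathbf A$ over $\mathcal V$ if the elements $\nu(p_i)$ generate $\mathbf A$, $\nu(A)=1$, and $\vdash_{\mathcal V}A\to B$ for every formula $B(\bar p)$ with $\nu(B)=1$; $\mathbf A$ is *finitely presentable over* $\mathcal V$ if some pair defines it over $\mathcal V$. If $\mathbf A\in\mathcal V$ is subdirectly irreducible (s.i.), $\langle A,\nu\rangle$ defines $\mathbf A$ over $\mathcal V$, and $\nu(B)$, for a formula $B(\bar p)$, is the opremum (the greatest element $\neq 1$) of $\mathbf A$, then $A\to B$ is a *characteristic formula over* $\mathcal V$. The *Jankov formula* of a finite s.i. algebra is $D\to p_\omega$, where $D$ is its diagram formula and $p_\omega$ is the variable of the opremum. A logic is *Jankov-axiomatizable* if it is axiomatized over intuitionistic logic by a set of Jankov formulas. The logics *axiomatizable by characteristic formulas* form the least class that contains intuitionistic logic, contains with any logics $L_i$ $(i\in I)$ the logic axiomatized by $\bigcup_i L_i$, and contains with a logic $L$ every logic axiomatized by $L\cup\Gamma$, where each member of $\Gamma$ is a characteristic formula over some variety that includes the variety of $L$ (for instance, over the variety of $L$ itself). **Theorem 6.8.** There exist intermediate logics that are not axiomatizable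 by characteristic formulas. More precisely: 1. If $\mathcal V\subseteq\mathcal{KG}$ is a variety, then every s.i. algebra in $\mathcal V$ that is finitely presentable over $\mathcal V$ is finite. 2. $\mathbf K\in\mathcal{KG}$, and there is a formula that is pre-true in $\mathbf K$. 3. Let $F$ be any formula that is pre-true in $\mathbf K$, let $\mathcal W=\{\mathbf A\in\mathcal{KG}:\mathbf A\models F\}$, and let $L=\mathrm{Log}(\mathcal W)$. Then $L$ is an intermediate logic, $L$ is not Jankov-axiomatizable, and $L$ is not axiomatizable by characteristic formulas. Moreover, if $\mathcal U$ is any variety containing $\mathbf K$ (such as the variety of all Heyting algebras, or $\mathcal{KG}$) and $\Gamma$ is any set of formulas each of which is a characteristic formula over some variety containing $\mathbf K$, then $\mathcal W\neq\{\mathbf A\in\mathcal U:\mathbf A\models\Gamma\}$. -/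

import Mathlib

namespace IntermediateLogic

/-! ### Formulas, validity, varieties -/

/-- Propositional formulas in the signature `∧, ∨, →, ¬`, over countably many variables. -/
inductive Formula : Type
  | var : ℕ → Formula
  | and : Formula → Formula → Formula
  | or : Formula → Formula → Formula
  | imp : Formula → Formula → Formula
  | neg : Formula → Formula

/-- `A ↔ B` abbreviates `(A → B) ∧ (B → A)`. -/
def Formula.iff (A B : Formula) : Formula := .and (.imp A B) (.imp B A)

/-- The (finite) set of variables occurring in a formula. -/
def Formula.vars : Formula → Finset ℕ
  | .var i => {i}
  | .and A B => A.vars ∪ B.vars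
  | .or A B => A.vars ∪ B.vars
  | .imp A B => A.vars ∪ B.vars
  | .neg A => A.vars

/-- Simultaneous substitution of formulas for variables. -/
def Formula.subst (σ : ℕ → Formula) : Formula → Formula
  | .var i => σ i
  | .and A B => .and (A.subst σ) (B.subst σ)
  | .or A B => .or (A.subst σ) (B.subst σ)
  | .imp A B => .imp (A.subst σ) (B.subst σ)
  | .neg A => .neg (A.subst σ)

/-- The value of a formula in a Heyting algebra under a valuation. -/
def Formula.eval {H : Type*} [HeytingAlgebra H] (v : ℕ → H) : Formula → H
  | .var i => v i
  | .and A B => A.eval v ⊓ B.eval v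
  | .or A B => A.eval v ⊔ B.eval v
  | .imp A B => A.eval v ⇨ B.eval v
  | .neg A => (A.eval v)ᶜ

/-- `H ⊨ A`: the formula takes the value `1` under every valuation. -/
def Valid (H : Type*) [HeytingAlgebra H] (A : Formula) : Prop :=
  ∀ v : ℕ → H, A.eval v = ⊤

/-- A variety of Heyting algebras is the class of all algebras that validate some set `V` of
formulas (an identity `s = t` amounts to the formula `s ↔ t`); it is represented by such a set.
`Mem V H` says that the algebra `H` belongs to the variety defined by `V`. -/
def Mem (V : Set Formula) (H : Type*) [HeytingAlgebra H] : Prop :=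
  ∀ A ∈ V, Valid H A

/-- `A ∈ Logic V` is `⊢_V A`: the formula `A` is valid in all algebras of the variety defined
by `V`.  Equivalently, `Logic V` is the logic axiomatized over intuitionistic logic by `V`.
Quantifying over the algebras in `Type` is no restriction, since a refuted formula is refuted in a
finitely generated, hence countable, algebra. -/
def Logic (V : Set Formula) : Set Formula :=
  {A | ∀ (H : Type) [HeytingAlgebra H], Mem V H → Valid H A}

/-- An intermediate logic: a set of formulas that lies between the intuitionistic and the
classical propositional logic and is closed under modus ponens and substitution. -/
structure IsIntermediateLogic (L : Set Formula) : Prop where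
  intuitionistic_subset : Logic ∅ ⊆ L
  subset_classical : ∀ A ∈ L, Valid Bool A
  modus_ponens : ∀ A B : Formula, A ∈ L → Formula.imp A B ∈ L → B ∈ L
  substitution : ∀ (A : Formula) (σ : ℕ → Formula), A ∈ L → A.subst σ ∈ L

/-! ### Subalgebras, subdirect irreducibility, pre-true formulas -/

/-- `S` is (the universe of) a subalgebra of `H`. -/
structure IsSubalgebra {H : Type*} [HeytingAlgebra H] (S : Set H) : Prop where
  bot_mem : ⊥ ∈ S
  top_mem : ⊤ ∈ S
  inf_mem : ∀ a ∈ S, ∀ b ∈ S, a ⊓ b ∈ S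
  sup_mem : ∀ a ∈ S, ∀ b ∈ S, a ⊔ b ∈ S
  himp_mem : ∀ a ∈ S, ∀ b ∈ S, a ⇨ b ∈ S
  compl_mem : ∀ a ∈ S, aᶜ ∈ S

/-- `H` is subdirectly irreducible: some pair of distinct elements lies in every congruence
(i.e. in the kernel of every homomorphism) other than the identity. -/
def IsSI (H : Type) [HeytingAlgebra H] : Prop :=
  ∃ a b : H, a ≠ b ∧
    ∀ (B : Type) [HeytingAlgebra B] (f : HeytingHom H B), ¬ Function.Injective f → f a = f b

/-- The opremum: the greatest among the elements distinct from `1`. -/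
def IsOpremum {H : Type*} [HeytingAlgebra H] (a : H) : Prop :=
  IsGreatest {x : H | x ≠ ⊤} a

/-- `F` is pre-true in `H`: it is not valid in `H`, but it is valid in all proper subalgebras and
in all proper homomorphic images of `H`. -/
structure PreTrue (F : Formula) (H : Type) [HeytingAlgebra H] : Prop where
  not_valid : ¬ Valid H F
  valid_subalgebra : ∀ S : Set H, IsSubalgebra S → S ≠ Set.univ →
    ∀ v : ℕ → H, (∀ i, v i ∈ S) → F.eval v = ⊤
  valid_image : ∀ (B : Type) [HeytingAlgebra B] (f : HeytingHom H B),
    Function.Surjective f → ¬ Function.Injective f → Valid B F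

/-! ### Finite presentations and characteristic formulas -/

/-- The pair `⟨A, ν⟩` defines `H` over the variety `V`, where `P` is the finite list of
variables involved. -/
structure Defines (V : Set Formula) {H : Type} [HeytingAlgebra H] (P : Finset ℕ)
    (A : Formula) (ν : ℕ → H) : Prop where
  vars_subset : A.vars ⊆ P
  generates : ∀ S : Set H, IsSubalgebra S → (∀ i ∈ P, ν i ∈ S) → S = Set.univ
  eval_eq_top : A.eval ν = ⊤
  complete : ∀ B : Formula, B.vars ⊆ P → B.eval ν = ⊤ → Formula.imp A B ∈ Logic V

/-- `H` is finitely presentable over the variety `V`. -/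
def FinitelyPresentable (V : Set Formula) (H : Type) [HeytingAlgebra H] : Prop :=
  ∃ (P : Finset ℕ) (A : Formula) (ν : ℕ → H), Defines V P A ν

/-- `χ` is a characteristic formula over the variety `V`: it is `A → B`, where `⟨A, ν⟩` defines
over `V` a subdirectly irreducible algebra `H` of `V` and the value of `B` is the opremum of `H`. -/
def IsCharFormula (V : Set Formula) (χ : Formula) : Prop :=
  ∃ (H : Type) (_ : HeytingAlgebra H) (P : Finset ℕ) (A B : Formula) (ν : ℕ → H),
    Mem V H ∧ IsSI H ∧ Defines V P A ν ∧ B.vars ⊆ P ∧ IsOpremum (B.eval ν) ∧ χ = .imp A B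

/-- The conjunction of a list of formulas (an empty conjunction is read as `p₀ → p₀`). -/
def bigAnd : List Formula → Formula
  | [] => .imp (.var 0) (.var 0)
  | [A] => A
  | A :: B :: l => .and A (bigAnd (B :: l))

/-- The diagram formula of a finite algebra whose elements are enumerated by `e`; the variable
`p_i` is associated with the `i`-th element. -/
def diagram {H : Type} [HeytingAlgebra H] {n : ℕ} (e : H ≃ Fin n) : Formula :=
  bigAnd
    ((List.finRange n).flatMap (fun i : Fin n => (List.finRange n).map (fun j : Fin n =>
        Formula.iff (.and (.var i) (.var j)) (.var (e (e.symm i ⊓ e.symm j))))) ++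
      (List.finRange n).flatMap (fun i : Fin n => (List.finRange n).map (fun j : Fin n =>
        Formula.iff (.or (.var i) (.var j)) (.var (e (e.symm i ⊔ e.symm j))))) ++
      (List.finRange n).flatMap (fun i : Fin n => (List.finRange n).map (fun j : Fin n =>
        Formula.iff (.imp (.var i) (.var j)) (.var (e (e.symm i ⇨ e.symm j))))) ++
      (List.finRange n).map (fun i : Fin n =>
        Formula.iff (.neg (.var i)) (.var (e (e.symm i)ᶜ))))

/-- `χ` is the Jankov formula of some finite subdirectly irreducible algebra. -/
def IsJankovFormula (χ : Formula) : Prop :=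
  ∃ (H : Type) (_ : HeytingAlgebra H) (n : ℕ) (e : H ≃ Fin n) (a : H),
    IsSI H ∧ IsOpremum a ∧ χ = .imp (diagram e) (.var (e a))

/-- The logic `L` is axiomatizable (over intuitionistic logic) by Jankov formulas. -/
def JankovAxiomatizable (L : Set Formula) : Prop :=
  ∃ G : Set Formula, (∀ χ ∈ G, IsJankovFormula χ) ∧ L = Logic G

/-- The logics axiomatizable by characteristic formulas: those that are obtained from
intuitionistic logic by adjoining, possibly repeatedly and transfinitely, characteristic formulas.
To a logic `L` already obtained one may adjoin any set of characteristic formulas over varieties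
`V` that include the variety of `L` (over the variety of `L` itself, for instance). -/
inductive CharAxiomatizable : Set Formula → Prop
  | intuitionistic : CharAxiomatizable (Logic ∅)
  | adjoin (L G : Set Formula) : CharAxiomatizable L →
      (∀ χ ∈ G, ∃ V : Set Formula, V ⊆ L ∧ IsCharFormula V χ) →
      CharAxiomatizable (Logic (L ∪ G))
  | join {ι : Type} (L : ι → Set Formula) : (∀ i, CharAxiomatizable (L i)) →
      CharAxiomatizable (Logic (⋃ i, L i))

/-! ### Concatenation -/

/-- The concatenation `A + B`: the algebra `B` is put onto `A`, and the top of `A` is glued to the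
bottom of `B`.  An element `a` of `A` is represented by `(a, ⊥)`, an element `b` of `B` by
`(⊤, b)`; the order is componentwise. -/
def Concat (A B : Type*) [HeytingAlgebra A] [HeytingAlgebra B] : Type _ :=
  {x : A × B // x.1 = ⊤ ∨ x.2 = ⊥}

namespace Concat

variable {A B : Type*} [HeytingAlgebra A] [HeytingAlgebra B]

instance : Lattice (Concat A B) :=
  Subtype.lattice
    (by
      rintro ⟨a, b⟩ ⟨c, d⟩ (h | h) (h' | h') <;> simp_all)
    (by
      rintro ⟨a, b⟩ ⟨c, d⟩ (h | h) (h' | h') <;> simp_all)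

instance : DistribLattice (Concat A B) where
  le_sup_inf x y z := (le_sup_inf : (x.1 ⊔ y.1) ⊓ (x.1 ⊔ z.1) ≤ x.1 ⊔ y.1 ⊓ z.1)

instance : BoundedOrder (Concat A B) where
  top := ⟨(⊤, ⊤), Or.inl rfl⟩
  le_top x := (le_top : x.1 ≤ ⊤)
  bot := ⟨(⊥, ⊥), Or.inr rfl⟩
  bot_le x := (bot_le : ⊥ ≤ x.1)

open Classical in
/-- The Heyting implication of `A + B` (the one determined by the order). -/
noncomputable instance : HeytingAlgebra (Concat A B) :=
  HeytingAlgebra.ofHImp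
    (fun x y => ⟨(x.1.1 ⇨ y.1.1, if x.1.1 ⇨ y.1.1 = ⊤ then x.1.2 ⇨ y.1.2 else ⊥), by
      by_cases h : x.1.1 ⇨ y.1.1 = ⊤
      · exact Or.inl h
      · exact Or.inr (if_neg h)⟩)
    (by
      rintro ⟨⟨a, a'⟩, ha⟩ ⟨⟨b, b'⟩, hb⟩ ⟨⟨c, c'⟩, hc⟩
      change (a ≤ b ⇨ c ∧ a' ≤ if b ⇨ c = ⊤ then b' ⇨ c' else ⊥) ↔ (a ⊓ b ≤ c ∧ a' ⊓ b' ≤ c')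
      by_cases h : b ⇨ c = ⊤
      · simp [h, ← le_himp_iff]
      · simp only [h, if_false, le_himp_iff, le_bot_iff]
        constructor
        · rintro ⟨h1, h2⟩
          exact ⟨h1, by simp [h2]⟩
        · rintro ⟨h1, -⟩
          refine ⟨h1, ?_⟩
          rcases ha with ha | ha
          · exact absurd (top_le_iff.1 (le_himp_iff.2 (ha ▸ h1))) h
          · exact ha)

end Concat

/-! ### The Rieger-Nishimura ladder and the Kuznetsov-Gerčiu algebra -/

/-- The points `w₀, w₁, w₂, …` of the Rieger-Nishimura frame. -/
@[ext]
structure RNPoint : Type where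
  idx : ℕ

/-- The point `w_n` sees exactly itself and the points `w_m` with `m + 2 ≤ n`; the points seen
from a point are here the points below it. -/
instance : PartialOrder RNPoint where
  le a b := a = b ∨ a.idx + 2 ≤ b.idx
  le_refl _ := Or.inl rfl
  le_trans a b c := by
    rintro (rfl | h) (rfl | h')
    · exact Or.inl rfl
    · exact Or.inr h'
    · exact Or.inr h
    · exact Or.inr (by omega)
  le_antisymm a b := by
    rintro (rfl | h) (h' | h')
    · rfl
    · rfl
    · exact h'.symm
    · omega

/-- The Rieger-Nishimura ladder `Z`, the free Heyting algebra on one generator, as the algebra of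
the sets of points of the Rieger-Nishimura frame that are closed under seeing; the free generator
is `{w₀}`. -/
abbrev ZLadder : Type := LowerSet RNPoint

/-- The seven-element one-generated Heyting algebra `Z₇`: the algebra of the frame of the points
`w₀, w₁, w₂, w₄` seen from `w₄`; it is generated by `{w₀}`. -/
abbrev Z7 : Type := LowerSet (Set.Iic (RNPoint.mk 4))

/-- The Kuznetsov-Gerčiu algebra `Z + Z₇ + Z₂`; here `Z₂` is the two-element algebra `Bool`. -/
abbrev KGAlgebra : Type := Concat (Concat ZLadder Z7) Bool

/-- The axiom `(p → q) ∨ (q → r) ∨ ((q → r) → r) ∨ (r → (p ∨ q))` of the logic `KG`. -/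
def kgAxiom : Formula :=
  .or (.or (.or (.imp (.var 0) (.var 1)) (.imp (.var 1) (.var 2)))
    (.imp (.imp (.var 1) (.var 2)) (.var 2)))
    (.imp (.var 2) (.or (.var 0) (.var 1)))

end IntermediateLogic

namespace IntermediateLogic

/-! ### Homomorphisms, subalgebras and evaluation -/

section Evaluation

variable {H H' : Type*} [HeytingAlgebra H] [HeytingAlgebra H']

/-! The core is a transfer principle, `IsCharFormula.valid_of_preTrue`. Let `F` be pre-true in an
infinite `K` of `KG`, and let `χ = A → B` be characteristic for `H` over a variety containing `K`.
If a valuation refutes `χ` in `K`, pass to the quotient `[⊥, a]`, where `a` is the value of `A`.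
There `A` is true, so the valuation extends to a homomorphism from `H`; it does not send the opremum
to `1`, hence it is an embedding. So `H` is in `KG` and, by the finiteness theorem, finite. If `a ≠
1`, then `H` embeds in a proper quotient of `K`; if `a = 1`, it is a finite and therefore proper
subalgebra of `K`. Either way `H` validates `F` but refutes `χ`, so `χ` does not follow from `F`
over `KG`. Thus characteristic formulas that do follow never exclude `K`, whereas `F` does. Jankov
formulas are covered, because a diagram formula defines its algebra over all Heyting algebras.

Finiteness (`finite_of_finitelyPresentable`): in an infinite finitely generated s.i. algebra of `KG`
the elements with finite principal ideals form an ideal without greatest element, and they are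
exactly the elements not above a certain `c` (`IsKG.exists_node`). A formula sees only a bounded
part of this ideal, so collapsing what is above `c` to `c` or to a large `d` of the ideal keeps the
defining formula true (`IsNode.exists_eval_eq_collapse`). The resulting homomorphism into `[⊥, c]`
fixes the ideal but sends `c` to `d`, against monotonicity.

For the pre-true formula, the first two conjuncts of `kgPremise` pin `p₀` down to the generator of
the ladder, and the others force a copy of the frame of `Z₇` strictly below the refuting point.
Hence a refutation occurs only at the root, with determined values (`eq_kgVal_of_refutes`) that
generate the algebra (`IsSubalgebra.eq_univ_of_kgVal`). -/

theorem Formula.map_eval (f : HeytingHom H H') (v : ℕ → H) (A : Formula) :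
    f (A.eval v) = A.eval (fun i => f (v i)) := by
  induction A with
  | var i => rfl
  | and A B hA hB => simp only [Formula.eval, map_inf, hA, hB]
  | or A B hA hB => simp only [Formula.eval, map_sup, hA, hB]
  | imp A B hA hB => simp only [Formula.eval, map_himp, hA, hB]
  | neg A hA => simp only [Formula.eval, map_compl, hA]

theorem Formula.eval_congr {v w : ℕ → H} (A : Formula) (h : ∀ i ∈ A.vars, v i = w i) :
    A.eval v = A.eval w := by
  induction A with
  | var i => exact h i (by simp [Formula.vars])
  | and A B hA hB | or A B hA hB | imp A B hA hB =>
    simp only [Formula.eval, hA fun i hi => h i (Finset.mem_union_left _ hi),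
      hB fun i hi => h i (Finset.mem_union_right _ hi)]
  | neg A hA => simp only [Formula.eval, hA h]

theorem Formula.eval_subst (v : ℕ → H) (σ : ℕ → Formula) (A : Formula) :
    (A.subst σ).eval v = A.eval (fun i => (σ i).eval v) := by
  induction A with
  | var i => rfl
  | and A B hA hB => simp only [Formula.eval, Formula.subst, hA, hB]
  | or A B hA hB => simp only [Formula.eval, Formula.subst, hA, hB]
  | imp A B hA hB => simp only [Formula.eval, Formula.subst, hA, hB]
  | neg A hA => simp only [Formula.eval, Formula.subst, hA]

theorem Formula.eval_iff_eq_top {v : ℕ → H} {A B : Formula} :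
    (Formula.iff A B).eval v = ⊤ ↔ A.eval v = B.eval v := by
  simp only [Formula.iff, Formula.eval, inf_eq_top_iff, himp_eq_top_iff]
  exact le_antisymm_iff.symm

theorem IsSubalgebra.of_himp {S : Set H} (bot : ⊥ ∈ S) (top : ⊤ ∈ S)
    (inf : ∀ a ∈ S, ∀ b ∈ S, a ⊓ b ∈ S) (sup : ∀ a ∈ S, ∀ b ∈ S, a ⊔ b ∈ S)
    (himp : ∀ a ∈ S, ∀ b ∈ S, a ⇨ b ∈ S) : IsSubalgebra S :=
  ⟨bot, top, inf, sup, himp, fun a ha => himp_bot a ▸ himp a ha ⊥ bot⟩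

theorem IsSubalgebra.range (f : HeytingHom H H') : IsSubalgebra (Set.range f) := by
  refine .of_himp ⟨⊥, map_bot f⟩ ⟨⊤, map_top f⟩ ?_ ?_ ?_
  · rintro _ ⟨a, rfl⟩ _ ⟨b, rfl⟩
    exact ⟨a ⊓ b, map_inf f a b⟩
  · rintro _ ⟨a, rfl⟩ _ ⟨b, rfl⟩
    exact ⟨a ⊔ b, map_sup f a b⟩
  · rintro _ ⟨a, rfl⟩ _ ⟨b, rfl⟩
    exact ⟨a ⇨ b, map_himp f a b⟩

theorem IsSubalgebra.comap {S : Set H'} (hS : IsSubalgebra S) (f : HeytingHom H H') :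
    IsSubalgebra {x | f x ∈ S} := by
  refine .of_himp ?_ ?_ (fun a ha b hb => ?_) (fun a ha b hb => ?_) (fun a ha b hb => ?_)
  · change f ⊥ ∈ S
    exact (map_bot f).symm ▸ hS.bot_mem
  · change f ⊤ ∈ S
    exact (map_top f).symm ▸ hS.top_mem
  · change f (a ⊓ b) ∈ S
    rw [map_inf]
    exact hS.inf_mem _ ha _ hb
  · change f (a ⊔ b) ∈ S
    rw [map_sup]
    exact hS.sup_mem _ ha _ hb
  · change f (a ⇨ b) ∈ S
    rw [map_himp]
    exact hS.himp_mem _ ha _ hb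

theorem Valid.of_surjective {A : Formula} (f : HeytingHom H H') (hf : Function.Surjective f)
    (h : Valid H A) : Valid H' A := by
  intro v
  choose g hg using hf
  have := Formula.map_eval f (fun i => g (v i)) A
  simp only [hg] at this
  rw [← this, h, map_top]

theorem Valid.of_injective {A : Formula} (f : HeytingHom H H') (hf : Function.Injective f)
    (h : Valid H' A) : Valid H A := by
  intro v
  apply hf
  rw [Formula.map_eval, h, map_top]

theorem Mem.of_surjective {V : Set Formula} (f : HeytingHom H H') (hf : Function.Surjective f)
    (h : Mem V H) : Mem V H' :=
  fun A hA => (h A hA).of_surjective f hf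

/-- Any element `≠ ⊤` sent to `⊤` would carry the opremum above it to `⊤`; so the kernel filter is
trivial. -/
theorem HeytingHom.injective_of_opremum {f : HeytingHom H H'} {a : H} (ha : IsOpremum a)
    (hf : f a ≠ ⊤) : Function.Injective f := by
  have key : ∀ x, f x = ⊤ → x = ⊤ := by
    intro x hx
    by_contra hne
    exact hf (top_le_iff.1 (hx ▸ OrderHomClass.mono f (ha.2 hne)))
  intro x y hxy
  apply le_antisymm <;> rw [← himp_eq_top_iff] <;> apply key <;> rw [map_himp, hxy, himp_self]

end Evaluation

theorem subset_Logic (V : Set Formula) : V ⊆ Logic V := fun _ hA _ _ h => h _ hA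

theorem Logic_anti {V W : Set Formula} (h : V ⊆ Logic W) : Logic V ⊆ Logic W :=
  fun _ hA H _ hW => hA H fun _ hB => h hB H hW

theorem Mem_Logic {V : Set Formula} {H : Type} [HeytingAlgebra H] (h : Mem V H) :
    Mem (Logic V) H := fun _ hA => hA H h

theorem isIntermediateLogic_Logic {V : Set Formula} (h : Mem V Bool) :
    IsIntermediateLogic (Logic V) where
  intuitionistic_subset := Logic_anti (Set.empty_subset _)
  subset_classical A hA := hA Bool h
  modus_ponens A B hA hAB H _ hV v := by
    have h1 := hA H hV v
    have h2 := hAB H hV v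
    rwa [Formula.eval, h1, top_himp] at h2
  substitution A σ hA H _ hV v := by
    rw [Formula.eval_subst]
    exact hA H hV _

/-! ### Principal quotients and the opremum -/

section Quotient

variable {H : Type*} [HeytingAlgebra H]

/-- The interval `[⊥, a]`, which is the quotient of `H` by the principal filter of `a`. -/
instance iicHeytingAlgebra (a : H) : HeytingAlgebra (Set.Iic a) where
  himp x y := ⟨a ⊓ (x.1 ⇨ y.1), inf_le_left⟩
  le_himp_iff x y z := by
    change x.1 ≤ a ⊓ (y.1 ⇨ z.1) ↔ x.1 ⊓ y.1 ≤ z.1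
    rw [le_inf_iff, le_himp_iff]
    exact and_iff_right x.2
  compl x := ⟨a ⊓ (x.1 ⇨ ⊥), inf_le_left⟩
  himp_bot _ := rfl
  bot_le := OrderBot.bot_le

theorem iic_coe_himp {a : H} (x y : Set.Iic a) : ((x ⇨ y : Set.Iic a) : H) = a ⊓ (x.1 ⇨ y.1) := rfl

/-- The quotient map of `H` onto `[⊥, a]`. -/
def iicHom (a : H) : HeytingHom H (Set.Iic a) where
  toFun x := ⟨a ⊓ x, inf_le_left⟩
  map_sup' x y := Subtype.ext (inf_sup_left a x y)
  map_inf' x y := Subtype.ext (inf_inf_distrib_left a x y)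
  map_bot' := Subtype.ext (inf_bot_eq a)
  map_himp' x y := by
    apply Subtype.ext
    change a ⊓ (x ⇨ y) = a ⊓ (a ⊓ x ⇨ a ⊓ y)
    apply le_antisymm
    · refine le_inf inf_le_left ?_
      rw [le_himp_iff]
      refine le_inf (inf_le_left.trans inf_le_left) ?_
      calc a ⊓ (x ⇨ y) ⊓ (a ⊓ x) ≤ (x ⇨ y) ⊓ x := inf_le_inf inf_le_right inf_le_right
        _ ≤ y := himp_inf_le
    · refine le_inf inf_le_left ?_
      rw [le_himp_iff]
      calc a ⊓ (a ⊓ x ⇨ a ⊓ y) ⊓ x ≤ (a ⊓ x ⇨ a ⊓ y) ⊓ (a ⊓ x) :=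
            le_inf (inf_le_left.trans inf_le_right)
              (le_inf (inf_le_left.trans inf_le_left) inf_le_right)
        _ ≤ a ⊓ y := himp_inf_le
        _ ≤ y := inf_le_right

theorem iicHom_apply (a x : H) : (iicHom a x : H) = a ⊓ x := rfl

theorem iicHom_surjective (a : H) : Function.Surjective (iicHom a) :=
  fun x => ⟨x.1, Subtype.ext (inf_eq_right.2 x.2)⟩

theorem iicHom_eq_top {a x : H} : iicHom a x = ⊤ ↔ a ≤ x := by
  rw [Subtype.ext_iff]
  exact inf_eq_left

theorem iicHom_not_injective {a : H} (ha : a ≠ ⊤) : ¬ Function.Injective (iicHom a) :=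
  fun h => ha (h ((iicHom_eq_top.2 le_rfl).trans (map_top _).symm))

theorem IsOpremum.sup_ne_top {o : H} (ho : IsOpremum o) {x y : H} (hx : x ≠ ⊤) (hy : y ≠ ⊤) :
    x ⊔ y ≠ ⊤ :=
  fun h => ho.1 (top_le_iff.1 (h ▸ sup_le (ho.2 hx) (ho.2 hy)))

end Quotient

/-- For `x ≠ ⊤` the quotient by the filter of `x` identifies the critical pair `a`, `b`, that is,
`x` lies below `a ⇔ b`. -/
theorem IsSI.exists_opremum {H : Type} [HeytingAlgebra H] (h : IsSI H) :
    ∃ o : H, IsOpremum o := by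
  obtain ⟨a, b, hab, h⟩ := h
  refine ⟨(a ⇨ b) ⊓ (b ⇨ a), ?_, ?_⟩
  · intro h
    rw [inf_eq_top_iff, himp_eq_top_iff, himp_eq_top_iff] at h
    exact hab (le_antisymm h.1 h.2)
  · intro x hx
    have := congrArg Subtype.val (h _ (iicHom x) (iicHom_not_injective hx))
    rw [iicHom_apply, iicHom_apply] at this
    refine le_inf ?_ ?_ <;> rw [le_himp_iff]
    · exact this.trans_le inf_le_right
    · exact this.symm.trans_le inf_le_right

/-! ### Finite presentations -/

section Presentation

variable {V : Set Formula} {H : Type} [HeytingAlgebra H] {P : Finset ℕ} {A : Formula} {ν : ℕ → H}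

theorem Defines.exists_formula (h : Defines V P A ν) (x : H) :
    ∃ B : Formula, B.vars ⊆ P ∧ B.eval ν = x := by
  suffices hS : {x | ∃ B : Formula, B.vars ⊆ P ∧ B.eval ν = x} = Set.univ from
    hS.ge (Set.mem_univ x)
  refine h.generates _ (.of_himp ?_ ?_ ?_ ?_ ?_) ?_
  -- The signature has no constants: the true formula `A` stands for `1` and its negation for `0`.
  · exact ⟨.neg A, h.vars_subset, by rw [Formula.eval, h.eval_eq_top, compl_top]⟩
  · exact ⟨A, h.vars_subset, h.eval_eq_top⟩
  · rintro _ ⟨B, hB, rfl⟩ _ ⟨C, hC, rfl⟩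
    exact ⟨.and B C, Finset.union_subset hB hC, rfl⟩
  · rintro _ ⟨B, hB, rfl⟩ _ ⟨C, hC, rfl⟩
    exact ⟨.or B C, Finset.union_subset hB hC, rfl⟩
  · rintro _ ⟨B, hB, rfl⟩ _ ⟨C, hC, rfl⟩
    exact ⟨.imp B C, Finset.union_subset hB hC, rfl⟩
  · exact fun i hi => ⟨.var i, by simpa [Formula.vars] using hi, rfl⟩

/-- A valuation that makes the defining formula true extends to a homomorphism. -/
theorem Defines.exists_hom (h : Defines V P A ν) {H' : Type} [HeytingAlgebra H'] (hV : Mem V H')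
    (v : ℕ → H') (hv : A.eval v = ⊤) :
    ∃ f : HeytingHom H H', ∀ B : Formula, B.vars ⊆ P → f (B.eval ν) = B.eval v := by
  choose t ht hte using h.exists_formula
  -- Well-definedness: if `B` and `C` agree in `H`, completeness makes `A → (B ↔ C)` valid in the
  -- variety.
  have key : ∀ B C : Formula, B.vars ⊆ P → C.vars ⊆ P → B.eval ν = C.eval ν →
      B.eval v = C.eval v := by
    intro B C hB hC hBC
    have h1 := h.complete (Formula.iff B C)
      (Finset.union_subset (Finset.union_subset hB hC) (Finset.union_subset hC hB))
      (Formula.eval_iff_eq_top.2 hBC) H' hV v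
    rw [Formula.eval, hv, top_himp] at h1
    exact Formula.eval_iff_eq_top.1 h1
  refine ⟨{
    toFun := fun x => (t x).eval v
    map_sup' := fun x y => key _ (.or (t x) (t y)) (ht _) (Finset.union_subset (ht _) (ht _))
      (by simp only [Formula.eval, hte])
    map_inf' := fun x y => key _ (.and (t x) (t y)) (ht _) (Finset.union_subset (ht _) (ht _))
      (by simp only [Formula.eval, hte])
    map_himp' := fun x y => key _ (.imp (t x) (t y)) (ht _) (Finset.union_subset (ht _) (ht _))
      (by simp only [Formula.eval, hte])
    map_bot' := ?_ }, fun B hB => key _ _ (ht _) hB (hte _)⟩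
  have := key (t ⊥) (.neg A) (ht _) h.vars_subset
    (by simp only [Formula.eval, hte, h.eval_eq_top, compl_top])
  change (t ⊥).eval v = ⊥
  rw [this, Formula.eval, hv, compl_top]

end Presentation

/-! ### Finitely generated algebras and their finite principal ideals -/

section Finite

variable {H : Type*} [HeytingAlgebra H]

/-- `G` generates `H`. -/
def Generates (G : Finset H) : Prop :=
  ∀ S : Set H, IsSubalgebra S → (∀ x ∈ G, x ∈ S) → S = Set.univ

/-- The principal ideal of `x` is finite. -/
def FiniteBelow (x : H) : Prop := (Set.Iic x).Finite

theorem FiniteBelow.mono {x y : H} (hy : FiniteBelow y) (h : x ≤ y) : FiniteBelow x :=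
  Set.Finite.subset hy (Set.Iic_subset_Iic.2 h)

theorem FiniteBelow.sup {x y : H} (hx : FiniteBelow x) (hy : FiniteBelow y) :
    FiniteBelow (x ⊔ y) := by
  refine (Set.Finite.image2 (· ⊔ ·) hx hy).subset fun z hz => ?_
  exact ⟨z ⊓ x, inf_le_right, z ⊓ y, inf_le_right, by
    change z ⊓ x ⊔ z ⊓ y = z
    rw [← inf_sup_left, inf_eq_left.2 hz]⟩

theorem finiteBelow_bot : FiniteBelow (⊥ : H) := by
  simp [FiniteBelow]

theorem not_finiteBelow_top [Infinite H] : ¬ FiniteBelow (⊤ : H) := by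
  rw [FiniteBelow, Set.Iic_top]
  exact Set.infinite_univ

/-- Go through `G`, replacing `y` by `y ⊓ u` whenever this is still not below `m`. -/
theorem exists_deciding (G : Finset H) {m x : H} (hx : ¬ x ≤ m) :
    ∃ y ≤ x, ¬ y ≤ m ∧ ∀ u ∈ G, y ≤ u ∨ y ⊓ u ≤ m := by
  classical
  induction G using Finset.induction_on with
  | empty => exact ⟨x, le_rfl, hx, by simp⟩
  | insert u G _ ih =>
    obtain ⟨y, hyx, hym, hy⟩ := ih
    by_cases h : y ⊓ u ≤ m
    · refine ⟨y, hyx, hym, fun v hv => ?_⟩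
      rcases Finset.mem_insert.1 hv with rfl | hv
      · exact Or.inr h
      · exact hy v hv
    · refine ⟨y ⊓ u, inf_le_left.trans hyx, h, fun v hv => ?_⟩
      rcases Finset.mem_insert.1 hv with rfl | hv
      · exact Or.inl inf_le_right
      · exact (hy v hv).imp inf_le_left.trans (inf_le_inf_right _ inf_le_left).trans

/-- In a finitely generated algebra a finite principal ideal is covered by another one. -/
theorem Generates.exists_finiteBelow_gt {G : Finset H} (hG : Generates G) {m x : H}
    (hm : FiniteBelow m) (hx : ¬ x ≤ m) : ∃ m', FiniteBelow m' ∧ m < m' ∧ m' ≤ m ⊔ x := by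
  obtain ⟨y₀, hy₀x, hy₀m, hy₀⟩ := exists_deciding G hx
  -- Minimality of `t` lets `y` decide implications: if `t` is not below `B ⇨ C`, then `t ⊓ (B ⇨ C)`
  -- is smaller and hence no candidate, which gives `y ⊓ (B ⇨ C) ≤ m`.
  obtain ⟨t, ⟨htm, ht⟩, hmin⟩ : ∃ t, Minimal (fun t => t ≤ m ∧ ¬ y₀ ⊓ (m ⇨ t) ≤ m) t :=
    (Set.Finite.subset hm (t := {t | t ≤ m ∧ ¬ y₀ ⊓ (m ⇨ t) ≤ m}) fun t ht => ht.1).exists_minimal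
      ⟨m, le_rfl, by simpa using hy₀m⟩
  set y := y₀ ⊓ (m ⇨ t) with hy
  have hym : y ⊓ m ≤ t := (inf_le_inf_right _ inf_le_right).trans himp_inf_le
  have hlt : ∀ s, s < t → y ⊓ (m ⇨ s) ≤ m := by
    intro s hs
    by_contra hcon
    refine hs.not_ge (hmin ⟨hs.le.trans htm, fun h => hcon ?_⟩ hs.le)
    exact (inf_le_inf_right _ inf_le_left).trans h
  have key : ∀ B, y ≤ B ∨ y ⊓ B ≤ m := by
    suffices h : {B | y ≤ B ∨ y ⊓ B ≤ m} = Set.univ from fun B => h.ge (Set.mem_univ B)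
    refine hG _ (.of_himp (Or.inr (by simp)) (Or.inl le_top) ?_ ?_ ?_) ?_
    · rintro B (hB | hB) C (hC | hC)
      · exact Or.inl (le_inf hB hC)
      · exact Or.inr ((inf_le_inf_left _ inf_le_right).trans hC)
      · exact Or.inr ((inf_le_inf_left _ inf_le_left).trans hB)
      · exact Or.inr ((inf_le_inf_left _ inf_le_left).trans hB)
    · rintro B (hB | hB) C (hC | hC)
      · exact Or.inl (hB.trans le_sup_left)
      · exact Or.inl (hB.trans le_sup_left)
      · exact Or.inl (hC.trans le_sup_right)
      · exact Or.inr (by rw [inf_sup_left]; exact sup_le hB hC)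
    · rintro B hB C (hC | hC)
      · exact Or.inl (hC.trans le_himp)
      rcases hB with hB | hB
      · refine Or.inr (le_trans (le_inf inf_le_left ?_) hC)
        exact (le_inf inf_le_right (inf_le_left.trans hB)).trans himp_inf_le
      · by_cases he : t ≤ B ⇨ C
        · left
          have h1 : y ⊓ B ≤ B ⇨ C := (le_inf inf_le_left hB).trans (hym.trans he)
          exact le_himp_iff.2 ((le_inf h1 inf_le_right).trans himp_inf_le)
        · right
          refine le_trans (le_inf inf_le_left ?_) (hlt (t ⊓ (B ⇨ C)) (inf_lt_left.2 he))
          rw [le_himp_iff]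
          exact le_inf ((inf_le_inf_right _ inf_le_left).trans hym)
            (inf_le_left.trans inf_le_right)
    · exact fun u hu => (hy₀ u hu).imp inf_le_left.trans (inf_le_inf_right _ inf_le_left).trans
  refine ⟨m ⊔ y, ?_, left_lt_sup.2 ht, sup_le_sup_left (inf_le_left.trans hy₀x) _⟩
  -- An element below `m ⊔ y` is below `m`, or contains `y` and is determined by its meet with `m`.
  refine ((hm.union (Set.Finite.image (· ⊔ y) hm))).subset fun z hz => ?_
  have hz' : z = z ⊓ m ⊔ z ⊓ y := by rw [← inf_sup_left, inf_eq_left.2 hz]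
  rcases key z with h | h
  · right
    exact ⟨z ⊓ m, inf_le_right, by
      change z ⊓ m ⊔ y = z
      rw [inf_eq_right.2 h] at hz'
      exact hz'.symm⟩
  · left
    rw [hz']
    exact sup_le inf_le_right (by rwa [inf_comm])

/-- A minimal `e ≤ y` with `¬ e ≤ x` is join-prime: if `e ≤ b ⊔ c` with `e` below neither, then `e ⊓
b` and `e ⊓ c` are smaller, hence below `x`, and so is `e`. -/
theorem FiniteBelow.exists_supPrime {x y : H} (hy : FiniteBelow y) (h : ¬ y ≤ x) :
    ∃ e ≤ y, SupPrime e ∧ ¬ e ≤ x := by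
  obtain ⟨e, ⟨hey, hex⟩, hmin⟩ : ∃ e, Minimal (fun e => e ≤ y ∧ ¬ e ≤ x) e :=
    (Set.Finite.subset hy (t := {e | e ≤ y ∧ ¬ e ≤ x}) fun e he => he.1).exists_minimal
      ⟨y, le_rfl, h⟩
  refine ⟨e, hey, ⟨fun h => hex (h.eq_bot ▸ bot_le), fun {b c} hbc => ?_⟩, hex⟩
  by_contra! hcon
  have hb : ∀ b, ¬ e ≤ b → e ⊓ b ≤ x := by
    intro b hb
    by_contra hx
    exact hb (le_inf_iff.1 (hmin ⟨inf_le_left.trans hey, hx⟩ inf_le_left)).2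
  apply hex
  calc e = e ⊓ b ⊔ e ⊓ c := by rw [← inf_sup_left, inf_eq_left.2 hbc]
    _ ≤ x := sup_le (hb b hcon.1) (hb c hcon.2)

/-- The form that the Kuznetsov-Gerčiu condition takes in well-connected algebras. -/
def IsKG (H : Type*) [HeytingAlgebra H] : Prop :=
  ∀ p q r : H, p ≤ q ∨ q ≤ r ∨ q ⇨ r ≤ r ∨ r ≤ p ⊔ q

/-- In an algebra of the variety `KG`, a join-prime element with a finite principal ideal has a
finite splitting partner. -/
theorem IsKG.exists_finiteBelow (hKG : IsKG H) {G : Finset H} (hG : Generates G) {e : H}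
    (he : FiniteBelow e) (hp : SupPrime e) :
    ∃ x₀, FiniteBelow x₀ ∧ ∀ x, e ≤ x ∨ x ≤ x₀ := by
  have hfin : (Set.Iio e).Finite := he.subset Set.Iio_subset_Iic_self
  -- `m` is the join of the elements strictly below `e`; join-primality keeps `e` from being below
  -- it.
  obtain ⟨m, hm, hem, hme⟩ : ∃ m, FiniteBelow m ∧ ¬ e ≤ m ∧ ∀ z, z < e → z ≤ m := by
    refine ⟨hfin.toFinset.sup id, he.mono (Finset.sup_le fun z hz => ?_), fun h => ?_,
      fun z hz => ?_⟩
    · exact (hfin.mem_toFinset.1 hz).le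
    · obtain ⟨z, hz, hez⟩ := hp.le_finset_sup.1 h
      exact (hfin.mem_toFinset.1 hz).not_ge hez
    · exact Finset.le_sup (f := id) (hfin.mem_toFinset.2 hz)
  have inf_le : ∀ x, ¬ e ≤ x → x ⊓ e ≤ m := fun x hx => hme _ (inf_lt_right.2 hx)
  -- Above `m`, chains that avoid `e` are short: with `p = x₁`, `q = e`, `r = x₂` each disjunct of
  -- the `KG` condition fails.
  have chain : ∀ x₁ x₂ x₃, m < x₁ → x₁ < x₂ → x₂ < x₃ → ¬ e ≤ x₃ → False := by
    intro x₁ x₂ x₃ h₁ h₂ h₃ hx₃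
    have hx₂ : ¬ e ≤ x₂ := fun h => hx₃ (h.trans h₃.le)
    have hx₁ : ¬ e ≤ x₁ := fun h => hx₂ (h.trans h₂.le)
    rcases hKG x₁ e x₂ with h | h | h | h
    · exact h₁.not_ge ((le_inf le_rfl h).trans (inf_le _ hx₁))
    · exact hx₂ h
    · refine h₃.not_ge (le_trans (le_himp_iff.2 ?_) h)
      exact (inf_le _ hx₃).trans (h₁.trans h₂).le
    · refine h₂.not_ge ?_
      calc x₂ = x₂ ⊓ x₁ ⊔ x₂ ⊓ e := by rw [← inf_sup_left, inf_eq_left.2 h]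
        _ ≤ x₁ := sup_le inf_le_right ((inf_le _ hx₂).trans h₁.le)
  by_contra! hcon
  have step : ∀ x, FiniteBelow x → ¬ e ≤ x → ∃ x', FiniteBelow x' ∧ x < x' ∧ ¬ e ≤ x' := by
    intro x hx hex
    obtain ⟨z, hez, hzx⟩ := hcon x hx
    obtain ⟨x', h1, h2, h3⟩ := hG.exists_finiteBelow_gt hx hzx
    exact ⟨x', h1, h2, fun h => (hp.2 (h.trans h3)).elim hex hez⟩
  obtain ⟨x₁, f₁, l₁, n₁⟩ := step m hm hem
  obtain ⟨x₂, f₂, l₂, n₂⟩ := step x₁ f₁ n₁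
  obtain ⟨x₃, f₃, l₃, n₃⟩ := step x₂ f₂ n₂
  exact chain x₁ x₂ x₃ l₁ l₂ l₃ n₃

/-- A join-prime `e ≤ y` not below `x` would put `x` below the finite splitting partner of `e`. -/
theorem IsKG.le_of_not_finiteBelow (hKG : IsKG H) {G : Finset H} (hG : Generates G) {x y : H}
    (hx : ¬ FiniteBelow x) (hy : FiniteBelow y) : y ≤ x := by
  by_contra h
  obtain ⟨e, hey, hp, hex⟩ := hy.exists_supPrime h
  obtain ⟨x₀, h₀, hx₀⟩ := hKG.exists_finiteBelow hG (hy.mono hey) hp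
  exact hx (h₀.mono ((hx₀ x).resolve_left hex))

/-- Put into `c` a join-prime `e` not below `m` and its splitting partner. Then `c ⇨ y` is not above
`e`, hence is below the partner and so below `c`. This supplies the `d` used for collapsing. -/
theorem IsKG.exists_himp_le (hKG : IsKG H) [Infinite H] {G : Finset H} (hG : Generates G) {m : H}
    (hm : FiniteBelow m) : ∃ c, FiniteBelow c ∧ m ≤ c ∧ ∀ y ≤ m, c ⇨ y ≤ y := by
  obtain ⟨m', hm', hlt, -⟩ := hG.exists_finiteBelow_gt hm (x := ⊤)
    fun h => not_finiteBelow_top (hm.mono h)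
  obtain ⟨e, hem', hp, hem⟩ := hm'.exists_supPrime hlt.not_ge
  have he := hm'.mono hem'
  obtain ⟨x₀, h₀, hx₀⟩ := hKG.exists_finiteBelow hG he hp
  refine ⟨m ⊔ e ⊔ x₀, (hm.sup he).sup h₀, le_sup_left.trans le_sup_left, fun y hy => ?_⟩
  set c := m ⊔ e ⊔ x₀
  have hec : e ≤ c := le_sup_right.trans le_sup_left
  have h : c ⇨ y ≤ x₀ := by
    refine (hx₀ _).resolve_left fun h => hem (le_trans ?_ hy)
    exact (le_inf h hec).trans himp_inf_le
  exact (le_inf le_rfl (h.trans le_sup_right)).trans himp_inf_le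

/-- The finite principal ideals of a finitely generated infinite algebra of the variety `KG` have a
supremum, which is comparable with all elements. -/
theorem IsKG.exists_node (hKG : IsKG H) [Infinite H] {G : Finset H} (hG : Generates G) :
    ∃ c : H, ∀ x, FiniteBelow x ↔ ¬ c ≤ x := by
  classical
  -- If all generators have finite principal ideals, the empty meet gives `c = ⊤`.
  set c := (G.filter fun u => ¬ FiniteBelow u).inf id
  have hc : ∀ y, FiniteBelow y → y ≤ c := fun y hy =>
    Finset.le_inf fun u hu => hKG.le_of_not_finiteBelow hG (Finset.mem_filter.1 hu).2 hy
  have nomax : ∀ y, FiniteBelow y → ∃ z, FiniteBelow z ∧ ¬ z ≤ y := fun y hy =>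
    let ⟨z, hz, hyz, _⟩ := hG.exists_finiteBelow_gt hy (x := ⊤)
      fun h => not_finiteBelow_top (hy.mono h)
    ⟨z, hz, hyz.not_ge⟩
  have hcfin : ¬ FiniteBelow c := fun h => let ⟨z, hz, hzc⟩ := nomax c h; hzc (hc z hz)
  have key : ∀ x, FiniteBelow x ∨ c ≤ x := by
    suffices h : {x | FiniteBelow x ∨ c ≤ x} = Set.univ from fun x => h.ge (Set.mem_univ x)
    refine hG _ (.of_himp (Or.inl finiteBelow_bot) (Or.inr le_top) ?_ ?_ ?_) ?_
    · rintro x (hx | hx) y (hy | hy)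
      · exact Or.inl (hx.mono inf_le_left)
      · exact Or.inl (hx.mono inf_le_left)
      · exact Or.inl (hy.mono inf_le_right)
      · exact Or.inr (le_inf hx hy)
    · rintro x (hx | hx) y (hy | hy)
      · exact Or.inl (hx.sup hy)
      · exact Or.inr (hy.trans le_sup_right)
      · exact Or.inr (hx.trans le_sup_left)
      · exact Or.inr (hx.trans le_sup_left)
    · rintro x hx y (hy | hy)
      · by_cases h : FiniteBelow (x ⇨ y)
        · exact Or.inl h
        right
        have hle : ∀ z, FiniteBelow z → z ≤ x ⇨ y := fun z hz => hKG.le_of_not_finiteBelow hG h hz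
        rcases hx with hx | hx
        · have : x ≤ y := (le_inf (hle x hx) le_rfl).trans himp_inf_le
          rw [himp_eq_top_iff.2 this]
          exact le_top
        · obtain ⟨z, hz, hzy⟩ := nomax y hy
          exact absurd ((le_inf (hle z hz) ((hc z hz).trans hx)).trans himp_inf_le) hzy
      · exact Or.inr (hy.trans le_himp)
    · intro u hu
      by_cases h : FiniteBelow u
      · exact Or.inl h
      · exact Or.inr (Finset.inf_le (f := id) (Finset.mem_filter.2 ⟨hu, h⟩))
  exact ⟨c, fun x => ⟨fun hx h => hcfin (hx.mono h), (key x).resolve_right⟩⟩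

end Finite

/-! ### Finitely presentable subdirectly irreducible algebras of `KG` -/

/-- With an opremum, a join equal to `⊤` has a member equal to `⊤`. -/
theorem isKG_of_valid {H : Type*} [HeytingAlgebra H] (h : Valid H kgAxiom) {o : H}
    (ho : IsOpremum o) : IsKG H := by
  intro p q r
  by_contra! hcon
  obtain ⟨h1, h2, h3, h4⟩ := hcon
  have := h fun i => if i = 0 then p else if i = 1 then q else r
  simp only [kgAxiom, Formula.eval] at this
  refine ho.sup_ne_top (ho.sup_ne_top (ho.sup_ne_top ?_ ?_) ?_) ?_ this <;> simpa

/-! ### Collapsing the elements above a node -/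

section Collapse

variable {H : Type*} [HeytingAlgebra H] {c y d : H}

open Classical in
/-- The elements above `c` are collapsed to `c` if they are above `y`, and to `d` otherwise. -/
noncomputable def collapse (c y d x : H) : H :=
  if c ≤ x then if y ≤ x then c else d else x

theorem collapse_of_not_le {x : H} (h : ¬ c ≤ x) : collapse c y d x = x := if_neg h

theorem collapse_of_le {x : H} (h : c ≤ x) (h' : y ≤ x) : collapse c y d x = c := by
  rw [collapse, if_pos h, if_pos h']

theorem collapse_of_le_of_not_le {x : H} (h : c ≤ x) (h' : ¬ y ≤ x) : collapse c y d x = d := by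
  rw [collapse, if_pos h, if_neg h']

/-- `c` is comparable with all elements and not a join of two smaller ones, and `y` decides all
elements relative to `c`. -/
structure IsNode (c y : H) : Prop where
  le_of_not_le : ∀ x, ¬ c ≤ x → x ≤ c
  sup_not_le : ∀ x z, ¬ c ≤ x → ¬ c ≤ z → ¬ c ≤ x ⊔ z
  ne_bot : c ≠ ⊥
  not_le : ¬ y ≤ c
  decides : ∀ x, y ≤ x ∨ y ⊓ x ≤ c

namespace IsNode

theorem collapse_le (h : IsNode c y) (hd : d ≤ c) (x : H) : collapse c y d x ≤ c := by
  unfold collapse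
  split_ifs with h1 h2
  · exact le_rfl
  · exact hd
  · exact h.le_of_not_le x h1

theorem collapse_inf (hd : d ≤ c) {a b : H} (ha : ¬ c ≤ a → a ≤ d)
    (hb : ¬ c ≤ b → b ≤ d) :
    collapse c y d (a ⊓ b) = collapse c y d a ⊓ collapse c y d b := by
  unfold collapse
  by_cases h1 : c ≤ a <;> by_cases h2 : c ≤ b
  · by_cases h3 : y ≤ a <;> by_cases h4 : y ≤ b <;> simp [h1, h2, h3, h4, hd]
  · simp only [le_inf_iff, h1, h2, and_false, if_false, if_true]
    rw [inf_eq_right.2 (((hb h2).trans hd).trans h1)]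
    split_ifs
    · exact (inf_eq_right.2 ((hb h2).trans hd)).symm
    · exact (inf_eq_right.2 (hb h2)).symm
  · simp only [le_inf_iff, h1, h2, false_and, if_false, if_true]
    rw [inf_eq_left.2 (((ha h1).trans hd).trans h2)]
    split_ifs
    · exact (inf_eq_left.2 ((ha h1).trans hd)).symm
    · exact (inf_eq_left.2 (ha h1)).symm
  · simp [h1, h2]

/-- If `y` were below `a ⊔ b` but below neither `a` nor `b`, then `y ⊓ a` and `y ⊓ b`, and so `y`
itself, would be below `c`. -/
theorem collapse_sup (h : IsNode c y) (hd : d ≤ c) {a b : H} (ha : ¬ c ≤ a → a ≤ d)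
    (hb : ¬ c ≤ b → b ≤ d) :
    collapse c y d (a ⊔ b) = collapse c y d a ⊔ collapse c y d b := by
  by_cases h1 : c ≤ a <;> by_cases h2 : c ≤ b
  · have h3 : c ≤ a ⊔ b := h1.trans le_sup_left
    by_cases h4 : y ≤ a
    · rw [collapse_of_le h3 (h4.trans le_sup_left), collapse_of_le h1 h4,
        sup_eq_left.2 (h.collapse_le hd b)]
    by_cases h5 : y ≤ b
    · rw [collapse_of_le h3 (h5.trans le_sup_right), collapse_of_le h2 h5,
        sup_eq_right.2 (h.collapse_le hd a)]
    rw [collapse_of_le_of_not_le h3, collapse_of_le_of_not_le h1 h4,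
      collapse_of_le_of_not_le h2 h5, sup_idem]
    intro h6
    apply h.not_le
    rw [← inf_eq_left.2 h6, inf_sup_left]
    exact sup_le ((h.decides a).resolve_left h4) ((h.decides b).resolve_left h5)
  · rw [sup_eq_left.2 (((hb h2).trans hd).trans h1), collapse_of_not_le h2, left_eq_sup]
    unfold collapse
    split_ifs
    · exact (hb h2).trans hd
    · exact hb h2
  · rw [sup_eq_right.2 (((ha h1).trans hd).trans h2), collapse_of_not_le h1, right_eq_sup]
    unfold collapse
    split_ifs
    · exact (ha h1).trans hd
    · exact ha h1
  · rw [collapse_of_not_le h1, collapse_of_not_le h2, collapse_of_not_le (h.sup_not_le _ _ h1 h2)]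

/-- The meet with `c` makes the right side the implication of `[⊥, c]`. The delicate case is `c ≤
a`, `¬ c ≤ b`: there `a ⇨ b = b`, and `d ⇨ b ≤ b` ensures that `d` behaves like `a`. -/
theorem collapse_himp (h : IsNode c y) (hd : d ≤ c) {a b : H} (ha : ¬ c ≤ a → a ≤ d)
    (hb : ¬ c ≤ b → d ⇨ b ≤ b) :
    collapse c y d (a ⇨ b) = c ⊓ (collapse c y d a ⇨ collapse c y d b) := by
  by_cases h2 : c ≤ b
  · have h3 : c ≤ a ⇨ b := h2.trans le_himp
    by_cases h5 : y ≤ b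
    · rw [collapse_of_le h3 (h5.trans le_himp), collapse_of_le h2 h5,
        himp_eq_top_iff.2 (h.collapse_le hd a), inf_top_eq]
    rw [collapse_of_le_of_not_le h2 h5]
    by_cases h1 : c ≤ a
    · by_cases h4 : y ≤ a
      · rw [collapse_of_le h1 h4, collapse_of_le_of_not_le h3, inf_himp, inf_eq_right.2 hd]
        exact fun h6 => h5 ((le_inf h6 h4).trans himp_inf_le)
      · rw [collapse_of_le_of_not_le h1 h4, himp_self, inf_top_eq, collapse_of_le h3]
        exact le_himp_iff.2 (((h.decides a).resolve_left h4).trans h2)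
    · rw [collapse_of_not_le h1, himp_eq_top_iff.2 (ha h1), inf_top_eq, collapse_of_le h3]
      rw [himp_eq_top_iff.2 ((h.le_of_not_le a h1).trans h2)]
      exact le_top
  rw [collapse_of_not_le h2]
  by_cases h1 : c ≤ a
  · have h3 : ¬ c ≤ a ⇨ b := fun h3 => h2 ((le_inf h3 h1).trans himp_inf_le)
    rw [collapse_of_not_le h3]
    have h4 : a ⇨ b ≤ b := (le_inf le_rfl ((h.le_of_not_le _ h3).trans h1)).trans himp_inf_le
    rw [le_antisymm h4 le_himp]
    refine le_antisymm (le_inf (h.le_of_not_le b h2) le_himp) ?_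
    by_cases h5 : y ≤ a
    · rw [collapse_of_le h1 h5, inf_himp]
      exact inf_le_right
    · rw [collapse_of_le_of_not_le h1 h5]
      exact inf_le_right.trans (hb h2)
  · rw [collapse_of_not_le h1]
    by_cases h3 : c ≤ a ⇨ b
    · have h4 : a ⇨ b = ⊤ := by
        rw [himp_eq_top_iff]
        exact (le_inf ((h.le_of_not_le a h1).trans h3) le_rfl).trans himp_inf_le
      rw [collapse_of_le h3 (h4 ▸ le_top), inf_eq_left.2 h3]
    · rw [collapse_of_not_le h3, inf_eq_right.2 (h.le_of_not_le _ h3)]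

/-- The collapsed valuation in `[⊥, c]`. -/
noncomputable def collapseVal (h : IsNode c y) (hd : d ≤ c) (ν : ℕ → H) : ℕ → Set.Iic c :=
  fun i => ⟨collapse c y d (ν i), Set.mem_Iic.2 (h.collapse_le hd _)⟩

/-- `m` bounds the finitely many values of proper subformulas that are not above `c`. It is chosen
before `d`, so that one `d` can serve several formulas. -/
theorem exists_eval_eq_collapse (h : IsNode c y) (hc : ∀ x, ¬ c ≤ x → FiniteBelow x)
    (ν : ℕ → H) (A : Formula) :
    ∃ m, FiniteBelow m ∧ ∀ d (hd : d ≤ c), m ≤ d → (∀ z ≤ m, d ⇨ z ≤ z) →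
      (A.eval (h.collapseVal hd ν)).1 =
        collapse c y d (A.eval ν) := by
  have part : ∀ x : H, ∃ m, FiniteBelow m ∧ (¬ c ≤ x → x ≤ m) := by
    intro x
    by_cases hx : c ≤ x
    · exact ⟨⊥, finiteBelow_bot, fun h => absurd hx h⟩
    · exact ⟨x, hc x hx, fun _ => le_rfl⟩
  have part₂ : ∀ {A B : Formula} {m₁ m₂ : H}, FiniteBelow m₁ → FiniteBelow m₂ →
      ∃ m, FiniteBelow m ∧ m₁ ≤ m ∧ m₂ ≤ m ∧ (¬ c ≤ A.eval ν → A.eval ν ≤ m) ∧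
        (¬ c ≤ B.eval ν → B.eval ν ≤ m) := by
    intro A B m₁ m₂ h₁ h₂
    obtain ⟨a, ha, ha'⟩ := part (A.eval ν)
    obtain ⟨b, hb, hb'⟩ := part (B.eval ν)
    exact ⟨m₁ ⊔ m₂ ⊔ (a ⊔ b), (h₁.sup h₂).sup (ha.sup hb), le_sup_left.trans le_sup_left,
      le_sup_right.trans le_sup_left, fun h => (ha' h).trans (le_sup_left.trans le_sup_right),
      fun h => (hb' h).trans (le_sup_right.trans le_sup_right)⟩
  have hbot : ¬ c ≤ ⊥ := fun hb => h.ne_bot (le_bot_iff.1 hb)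
  induction A with
  | var i => exact ⟨⊥, finiteBelow_bot, fun d hd _ _ => rfl⟩
  | and A B iA iB =>
    obtain ⟨m₁, f₁, e₁⟩ := iA
    obtain ⟨m₂, f₂, e₂⟩ := iB
    obtain ⟨m, f, h₁, h₂, hA, hB⟩ := part₂ (A := A) (B := B) f₁ f₂
    refine ⟨m, f, fun d hd hmd hz => ?_⟩
    rw [Formula.eval, Formula.eval, collapse_inf hd (fun h => (hA h).trans hmd)
      (fun h => (hB h).trans hmd), ← e₁ d hd (h₁.trans hmd) (fun z hz' => hz z (hz'.trans h₁)),
      ← e₂ d hd (h₂.trans hmd) (fun z hz' => hz z (hz'.trans h₂))]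
    rfl
  | or A B iA iB =>
    obtain ⟨m₁, f₁, e₁⟩ := iA
    obtain ⟨m₂, f₂, e₂⟩ := iB
    obtain ⟨m, f, h₁, h₂, hA, hB⟩ := part₂ (A := A) (B := B) f₁ f₂
    refine ⟨m, f, fun d hd hmd hz => ?_⟩
    rw [Formula.eval, Formula.eval, h.collapse_sup hd (fun h => (hA h).trans hmd)
      (fun h => (hB h).trans hmd), ← e₁ d hd (h₁.trans hmd) (fun z hz' => hz z (hz'.trans h₁)),
      ← e₂ d hd (h₂.trans hmd) (fun z hz' => hz z (hz'.trans h₂))]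
    rfl
  | imp A B iA iB =>
    obtain ⟨m₁, f₁, e₁⟩ := iA
    obtain ⟨m₂, f₂, e₂⟩ := iB
    obtain ⟨m, f, h₁, h₂, hA, hB⟩ := part₂ (A := A) (B := B) f₁ f₂
    refine ⟨m, f, fun d hd hmd hz => ?_⟩
    rw [Formula.eval, Formula.eval, h.collapse_himp hd (fun h => (hA h).trans hmd)
      (fun h => hz _ (hB h)), ← e₁ d hd (h₁.trans hmd) (fun z hz' => hz z (hz'.trans h₁)),
      ← e₂ d hd (h₂.trans hmd) (fun z hz' => hz z (hz'.trans h₂))]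
    rfl
  | neg A iA =>
    obtain ⟨m₁, f₁, e₁⟩ := iA
    obtain ⟨m, f, h₁, -, hA, -⟩ := part₂ (A := A) (B := A) f₁ f₁
    refine ⟨m, f, fun d hd hmd hz => ?_⟩
    rw [Formula.eval, Formula.eval, ← himp_bot (A.eval ν), h.collapse_himp hd
      (fun h => (hA h).trans hmd) (fun _ => hz _ bot_le),
      ← e₁ d hd (h₁.trans hmd) (fun z hz' => hz z (hz'.trans h₁)), collapse_of_not_le hbot]
    rfl

end IsNode

end Collapse

/-- If `H` were infinite, collapsed valuations in `[⊥, c]`, where `c` is the supremum of the elements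
with finite principal ideals, would satisfy the defining formula without extending to
homomorphisms. -/
theorem finite_of_finitelyPresentable {V : Set Formula} (hV : kgAxiom ∈ Logic V) {H : Type}
    [HeytingAlgebra H] (hH : Mem V H) (hSI : IsSI H) (hfp : FinitelyPresentable V H) :
    Finite H := by
  classical
  by_contra hfin
  rw [not_finite_iff_infinite] at hfin
  obtain ⟨P, A, ν, hD⟩ := hfp
  obtain ⟨o, ho⟩ := hSI.exists_opremum
  have hKG : IsKG H := isKG_of_valid (hV H hH) ho
  have hG : Generates (P.image ν) := fun S hS hP =>
    hD.generates S hS fun i hi => hP _ (Finset.mem_image_of_mem ν hi)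
  obtain ⟨c, hc⟩ := hKG.exists_node hG
  have le_c : ∀ x, FiniteBelow x → x ≤ c := fun x hx =>
    hKG.le_of_not_finiteBelow hG (fun h => (hc c).1 h le_rfl) hx
  have gt : ∀ x, FiniteBelow x → ∃ z, FiniteBelow z ∧ x < z := fun x hx =>
    let ⟨z, hz, hxz, _⟩ := hG.exists_finiteBelow_gt hx (x := ⊤)
      fun h => not_finiteBelow_top (hx.mono h)
    ⟨z, hz, hxz⟩
  -- If `c` were `⊤`, the opremum would have a finite principal ideal, and so would a strictly
  -- larger element, that is, `⊤`.
  have hctop : ¬ ⊤ ≤ c := by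
    intro h
    obtain ⟨z, hz, hoz⟩ := gt o ((hc o).2 fun h' => ho.1 (top_le_iff.1 (h.trans h')))
    exact hoz.not_ge (ho.2 fun hz' => not_finiteBelow_top (hz' ▸ hz))
  obtain ⟨y, -, hyc, hy⟩ := exists_deciding (P.image ν) hctop
  have hnode : IsNode c y := by
    refine ⟨fun x hx => le_c x ((hc x).2 hx), fun x z hx hz => (hc _).1 (((hc x).2 hx).sup
      ((hc z).2 hz)), fun h => (hc ⊥).1 finiteBelow_bot h.le, hyc, ?_⟩
    suffices h : {x | y ≤ x ∨ y ⊓ x ≤ c} = Set.univ from fun x => h.ge (Set.mem_univ x)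
    refine hG _ (.of_himp (Or.inr (by simp)) (Or.inl le_top) ?_ ?_ ?_) hy
    · rintro B (hB | hB) C (hC | hC)
      · exact Or.inl (le_inf hB hC)
      · exact Or.inr ((inf_le_inf_left _ inf_le_right).trans hC)
      · exact Or.inr ((inf_le_inf_left _ inf_le_left).trans hB)
      · exact Or.inr ((inf_le_inf_left _ inf_le_left).trans hB)
    · rintro B (hB | hB) C (hC | hC)
      · exact Or.inl (hB.trans le_sup_left)
      · exact Or.inl (hB.trans le_sup_left)
      · exact Or.inl (hC.trans le_sup_right)
      · exact Or.inr (by rw [inf_sup_left]; exact sup_le hB hC)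
    · rintro B hB C (hC | hC)
      · exact Or.inl (hC.trans le_himp)
      rcases hB with hB | hB
      · refine Or.inr (le_trans (le_inf inf_le_left ?_) hC)
        exact (le_inf inf_le_right (inf_le_left.trans hB)).trans himp_inf_le
      · by_cases h : c ≤ B ⇨ C
        · exact Or.inl (le_himp_iff.2 ((le_inf (hB.trans h) inf_le_right).trans himp_inf_le))
        · exact Or.inr (inf_le_right.trans (le_c _ ((hc _).2 h)))
  obtain ⟨C, hC, hCc⟩ := hD.exists_formula c
  obtain ⟨m₁, f₁, e₁⟩ := hnode.exists_eval_eq_collapse (fun x hx => (hc x).2 hx) ν A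
  obtain ⟨m₂, f₂, e₂⟩ := hnode.exists_eval_eq_collapse (fun x hx => (hc x).2 hx) ν C
  -- This `d` is large enough both for `A` and for the formula `C` of value `c`.
  obtain ⟨d, fd, hmd, hd⟩ := hKG.exists_himp_le hG (f₁.sup f₂)
  have e₁ := e₁ d (le_c d fd) (le_sup_left.trans hmd) fun z hz => hd z (hz.trans le_sup_left)
  have e₂ := e₂ d (le_c d fd) (le_sup_right.trans hmd) fun z hz => hd z (hz.trans le_sup_right)
  rw [hD.eval_eq_top, collapse_of_le le_top le_top] at e₁
  rw [hCc, collapse_of_le_of_not_le le_rfl hyc] at e₂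
  obtain ⟨f, hf⟩ := hD.exists_hom (hH.of_surjective (iicHom c) (iicHom_surjective c))
    (hnode.collapseVal (le_c d fd) ν)
    (Subtype.ext e₁)
  have hfc : (f c : H) = d := by
    rw [← e₂, ← hf C hC, hCc]
  -- The homomorphism can move only elements above `c`: so it is on the generators, and the
  -- operations preserve this.
  have hfix : ∀ x, c ≤ x ∨ (f x : H) = x := by
    suffices h : {x | c ≤ x ∨ (f x : H) = x} = Set.univ from fun x => h.ge (Set.mem_univ x)
    have hle : ∀ x, (f x : H) = x → x ≤ c := fun x hx => hx ▸ (f x).2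
    refine hD.generates _ (.of_himp ?_ (Or.inl le_top) ?_ ?_ ?_) ?_
    · right
      rw [map_bot]
      rfl
    · rintro a (ha | ha) b (hb | hb)
      · exact Or.inl (le_inf ha hb)
      · right
        rwa [inf_eq_right.2 ((hle b hb).trans ha)]
      · right
        rwa [inf_eq_left.2 ((hle a ha).trans hb)]
      · right
        rw [map_inf]
        exact congrArg₂ (· ⊓ ·) ha hb
    · rintro a (ha | ha) b (hb | hb)
      · exact Or.inl (ha.trans le_sup_left)
      · exact Or.inl (ha.trans le_sup_left)
      · exact Or.inl (hb.trans le_sup_right)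
      · right
        rw [map_sup]
        exact congrArg₂ (· ⊔ ·) ha hb
    · rintro a ha b (hb | hb)
      · exact Or.inl (hb.trans le_himp)
      by_cases h : c ≤ a ⇨ b
      · exact Or.inl h
      right
      rcases ha with ha | ha
      · have : a ⇨ b ≤ b :=
          (le_inf le_rfl ((le_c _ ((hc _).2 h)).trans ha)).trans himp_inf_le
        rwa [le_antisymm this le_himp]
      · rw [map_himp, iic_coe_himp, ha, hb, inf_eq_right.2 (le_c _ ((hc _).2 h))]
    · intro i hi
      by_cases h : c ≤ ν i
      · exact Or.inl h
      · right
        have := hf (.var i) (by simpa [Formula.vars] using hi)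
        simp only [Formula.eval] at this
        rw [this]
        exact collapse_of_not_le h
  obtain ⟨z, fz, hz⟩ := gt d fd
  have h1 : (f z : H) ≤ f c := OrderHomClass.mono f (le_c z fz)
  rw [(hfix z).resolve_left ((hc z).1 fz), hfc] at h1
  exact hz.not_ge h1

/-! ### Algebras of lower sets -/

section LowerSets

variable {X : Type*} [PartialOrder X]

theorem mem_himp_lowerSet {a b : LowerSet X} {w : X} :
    w ∈ a ⇨ b ↔ ∀ u ≤ w, u ∈ a → u ∈ b := by
  rw [← LowerSet.Iic_le, le_himp_iff]
  exact ⟨fun h u hu hua => h ⟨hu, hua⟩, fun h u hu => h u hu.1 hu.2⟩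

theorem mem_compl_lowerSet {a : LowerSet X} {w : X} : w ∈ aᶜ ↔ ∀ u ≤ w, u ∉ a := by
  rw [← himp_bot, mem_himp_lowerSet]
  exact Iff.rfl

theorem mem_Iic_himp_lowerSet {a w : X} {b : LowerSet X} (h : ∀ s < a, s ∈ b) (ha : a ∉ b) :
    w ∈ LowerSet.Iic a ⇨ b ↔ ¬ a ≤ w := by
  rw [mem_himp_lowerSet]
  refine ⟨fun hw haw => ha (hw a haw le_rfl), fun hw u huw hua => h u ?_⟩
  exact lt_of_le_of_ne hua fun h => hw (h ▸ huw)

/-- The points `a`, `b`, `d`, `c` witness the failure of the four disjuncts, in this order; `d ≤ c`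
would put `d` into `r`. -/
theorem isKG_lowerSet (hX : ∀ a b c d : X, ¬ a ≤ b → ¬ b ≤ c → ¬ c ≤ b → ¬ b ≤ d → ¬ d ≤ b →
    ¬ c ≤ a → d ≤ c) : IsKG (LowerSet X) := by
  intro p q r
  by_contra! hcon
  obtain ⟨h1, h2, h3, h4⟩ := hcon
  obtain ⟨a, hap, haq⟩ := Set.not_subset.1 h1
  obtain ⟨b, hbq, hbr⟩ := Set.not_subset.1 h2
  obtain ⟨d, hdqr, hdr⟩ := Set.not_subset.1 h3
  obtain ⟨c, hcr, hcpq⟩ := Set.not_subset.1 h4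
  have hcp : c ∉ p := fun h => hcpq (Or.inl h)
  have hcq : c ∉ q := fun h => hcpq (Or.inr h)
  have hd := mem_himp_lowerSet.1 hdqr
  exact hdr (r.lower (hX a b c d (fun h => haq (q.lower h hbq)) (fun h => hbr (r.lower h hcr))
    (fun h => hcq (q.lower h hbq)) (fun h => hbr (hd b h hbq))
    (fun h => hdr (hd d le_rfl (q.lower h hbq))) (fun h => hcp (p.lower h hap))) hcr)

end LowerSets

/-- Concatenations of algebras of lower sets are algebras of lower sets. -/
noncomputable def concatIso {A B P Q : Type*} [HeytingAlgebra A] [HeytingAlgebra B]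
    [PartialOrder P] [PartialOrder Q] (f : A ≃o LowerSet P) (g : B ≃o LowerSet Q) :
    Concat A B ≃o LowerSet (P ⊕ₗ Q) :=
  OrderIso.ofSurjective
    (OrderEmbedding.ofMapLEIff
      (fun x =>
        { carrier := {t | Sum.elim (· ∈ f x.1.1) (· ∈ g x.1.2) (ofLex t)}
          lower' := by
            rintro (s | s) (t | t) hts hs
            · exact (f x.1.1).lower (Sum.Lex.inl_le_inl_iff.1 hts) hs
            · exact absurd hts Sum.Lex.not_inr_le_inl
            · rcases x.2 with h | h
              · change t ∈ f x.1.1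
                rw [h, map_top]
                trivial
              · change s ∈ g x.1.2 at hs
                rw [h, map_bot] at hs
                exact hs.elim
            · exact (g x.1.2).lower (Sum.Lex.inr_le_inr_iff.1 hts) hs })
      (fun x y => by
        constructor
        · intro h
          exact ⟨f.le_iff_le.1 fun t ht => h (a := toLex (Sum.inl t)) ht,
            g.le_iff_le.1 fun t ht => h (a := toLex (Sum.inr t)) ht⟩
        · rintro h (t | t) ht
          · exact f.monotone h.1 ht
          · exact g.monotone h.2 ht))
    (by
      classical
      intro s
      let a : LowerSet P := ⟨{t | toLex (Sum.inl t) ∈ s}, fun t t' h ht =>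
        s.lower (Sum.Lex.inl_le_inl_iff.2 h) ht⟩
      let b : LowerSet Q := ⟨{t | toLex (Sum.inr t) ∈ s}, fun t t' h ht =>
        s.lower (Sum.Lex.inr_le_inr_iff.2 h) ht⟩
      refine ⟨⟨(f.symm a, g.symm b), ?_⟩, ?_⟩
      · by_cases hb : b = ⊥
        · exact Or.inr (by simp [hb])
        · left
          obtain ⟨t, ht⟩ : ∃ t, t ∈ b := by
            by_contra! h
            exact hb (le_bot_iff.1 fun t ht => h t ht)
          have ha : a = ⊤ := top_le_iff.1 fun u _ => s.lower (Sum.Lex.inl_le_inr u t) ht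
          simp [ha]
      · ext (t | t)
        · change t ∈ f (f.symm a) ↔ t ∈ a
          rw [f.apply_symm_apply]
        · change t ∈ g (g.symm b) ↔ t ∈ b
          rw [g.apply_symm_apply])

/-- The two-element algebra as the algebra of lower sets of a point. -/
noncomputable def boolIso : Bool ≃o LowerSet Unit :=
  OrderIso.ofSurjective
    (OrderEmbedding.ofMapLEIff (fun b => if b = true then ⊤ else ⊥) (by
      have : ¬ (⊤ : LowerSet Unit) ≤ ⊥ := fun h => h (a := ()) trivial
      rintro (_ | _) (_ | _) <;> simp [this]))
    (by
      intro s
      by_cases h : () ∈ s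
      · exact ⟨true, show (⊤ : LowerSet Unit) = s from (top_le_iff.1 fun _ _ => h).symm⟩
      · exact ⟨false, show (⊥ : LowerSet Unit) = s from (le_bot_iff.1 fun _ ht => h ht).symm⟩)

/-! ### The frame of the Kuznetsov-Gerčiu algebra -/

/-- The frame of the algebra `Z + Z₇ + Z₂`. -/
abbrev KGFrame : Type := (RNPoint ⊕ₗ Set.Iic (RNPoint.mk 4)) ⊕ₗ Unit

/-- The Kuznetsov-Gerčiu algebra is the algebra of lower sets of its frame. -/
noncomputable def kgIso : KGAlgebra ≃o LowerSet KGFrame :=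
  concatIso (concatIso (OrderIso.refl _) (OrderIso.refl _)) boolIso

namespace KGFrame

/-- The points of the ladder. -/
def rn (n : ℕ) : KGFrame := toLex (Sum.inl (toLex (Sum.inl ⟨n⟩)))

/-- The points of the frame of `Z₇`. -/
def mid (n : ℕ) (h : n = 4 ∨ n + 2 ≤ 4) : KGFrame :=
  toLex (Sum.inl (toLex (Sum.inr ⟨⟨n⟩, h.imp (congrArg RNPoint.mk) id⟩)))

/-- The point that sees all points. -/
def root : KGFrame := toLex (Sum.inr ())

theorem cases (t : KGFrame) : (∃ n, t = rn n) ∨ (∃ n h, t = mid n h) ∨ t = root := by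
  rcases t with (⟨⟨n⟩⟩ | ⟨⟨⟨n⟩, h⟩⟩) | ⟨⟨⟩⟩
  · exact Or.inl ⟨n, rfl⟩
  · exact Or.inr (Or.inl ⟨n, h.imp (congrArg RNPoint.idx) id, rfl⟩)
  · exact Or.inr (Or.inr rfl)

@[simp] theorem rn_le_rn {m n : ℕ} : rn m ≤ rn n ↔ m = n ∨ m + 2 ≤ n := by
  refine (Sum.Lex.inl_le_inl_iff.trans Sum.Lex.inl_le_inl_iff).trans ?_
  exact or_congr_left RNPoint.ext_iff

@[simp] theorem rn_le_mid {m n : ℕ} {h} : rn m ≤ mid n h :=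
  Sum.Lex.inl_le_inl_iff.2 (Sum.Lex.inl_le_inr _ _)

@[simp] theorem mid_le_mid {m n : ℕ} {h h'} : mid m h ≤ mid n h' ↔ m = n ∨ m + 2 ≤ n := by
  refine (Sum.Lex.inl_le_inl_iff.trans Sum.Lex.inr_le_inr_iff).trans ?_
  exact or_congr_left RNPoint.ext_iff

@[simp] theorem not_mid_le_rn {m n : ℕ} {h} : ¬ mid m h ≤ rn n :=
  fun hle => Sum.Lex.not_inr_le_inl (Sum.Lex.inl_le_inl_iff.1 hle)

@[simp] theorem le_root {t : KGFrame} : t ≤ root := by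
  rcases t with t | ⟨⟨⟩⟩
  · exact Sum.Lex.inl_le_inr _ _
  · exact le_rfl

@[simp] theorem not_root_le_rn {n : ℕ} : ¬ root ≤ rn n := Sum.Lex.not_inr_le_inl

@[simp] theorem not_root_le_mid {n : ℕ} {h} : ¬ root ≤ mid n h := Sum.Lex.not_inr_le_inl

theorem root_le_iff {t : KGFrame} : root ≤ t ↔ t = root :=
  ⟨fun h => le_antisymm le_root h, fun h => h.ge⟩

theorem rn_injective : Function.Injective rn := by
  intro m n h
  have h1 := rn_le_rn.1 h.le
  have h2 := rn_le_rn.1 h.ge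
  omega

end KGFrame

/-- In each layer the points incomparable with `w_j` are among `w_{j-1}` and `w_{j+1}`. So `¬ d ≤ c`
leaves `c = w_{j-1}`, `d = w_{j+1}`, but every point not above `w_{j-1}` is below `w_j`. -/
theorem isKG_kgFrame : IsKG (LowerSet KGFrame) := by
  apply isKG_lowerSet
  intro a b c d h1 h2 h3 h4 h5 h6
  rcases b.cases with ⟨j, rfl⟩ | ⟨j, hj, rfl⟩ | rfl
  · rcases c.cases with ⟨k, rfl⟩ | ⟨k, hk, rfl⟩ | rfl <;> try simp at h2
    rcases d.cases with ⟨l, rfl⟩ | ⟨l, hl, rfl⟩ | rfl <;> try simp at h4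
    rcases a.cases with ⟨i, rfl⟩ | ⟨i, hi, rfl⟩ | rfl <;> (simp at *; try omega)
  · rcases c.cases with ⟨k, rfl⟩ | ⟨k, hk, rfl⟩ | rfl <;> try simp at h2 h3
    rcases d.cases with ⟨l, rfl⟩ | ⟨l, hl, rfl⟩ | rfl <;> try simp at h4 h5
    rcases a.cases with ⟨i, rfl⟩ | ⟨i, hi, rfl⟩ | rfl <;> (simp at *; try omega)
  · simp at h3

instance : Infinite (LowerSet KGFrame) :=
  Infinite.of_injective (fun n => LowerSet.Iic (KGFrame.rn n))
    fun _ _ h => KGFrame.rn_injective (LowerSet.Iic_injective h)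

instance : Infinite KGAlgebra := kgIso.toEquiv.symm.infinite_iff.1 inferInstance

theorem IsKG.valid {H : Type*} [HeytingAlgebra H] (h : IsKG H) : Valid H kgAxiom := by
  intro v
  simp only [kgAxiom, Formula.eval]
  rcases h (v 0) (v 1) (v 2) with h | h | h | h <;> simp [himp_eq_top_iff.2 h]

/-- `kgIso` as a homomorphism. -/
noncomputable def kgHom : HeytingHom KGAlgebra (LowerSet KGFrame) := ↑kgIso

/-- The inverse of `kgIso` as a homomorphism. -/
noncomputable def kgSymmHom : HeytingHom (LowerSet KGFrame) KGAlgebra := ↑kgIso.symm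

theorem valid_kgAxiom : Valid KGAlgebra kgAxiom :=
  isKG_kgFrame.valid.of_surjective kgSymmHom kgIso.symm.surjective

open KGFrame

/-! ### A pre-true formula of the Kuznetsov-Gerčiu algebra -/

/-- The negation relative to the variable `p₁`. -/
def Formula.relNeg (A : Formula) : Formula := .imp A (.var 1)

/-- The premise of a formula that is pre-true in the Kuznetsov-Gerčiu algebra. -/
def kgPremise : Formula :=
  .and (.and (.and (.and (.and
    (.imp (.or (.neg (.var 0)) (.neg (.neg (.var 0)))) (.var 1))
    (.imp (.imp (.neg (.neg (.var 0))) (.var 0)) (.var 1)))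
    (.imp (.var 1) (.var 2)))
    (.imp (.imp (Formula.var 2).relNeg.relNeg (.var 2))
      (.or (.var 2) (Formula.var 2).relNeg)))
    (.imp (.or (Formula.var 2).relNeg.relNeg (Formula.var 2).relNeg) (.var 3)))
    (.imp (.imp (.var 3) (.or (Formula.var 2).relNeg.relNeg (Formula.var 2).relNeg))
      (.or (Formula.var 2).relNeg.relNeg (Formula.var 2).relNeg))

/-- A formula that is pre-true in the Kuznetsov-Gerčiu algebra: a refutation of it generates the
whole algebra and takes place at the root of its frame only. -/
def kgPreTrue : Formula := .imp kgPremise (.var 3)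

/-- The lower set of all points of the ladder. -/
def ladder : LowerSet KGFrame where
  carrier := {t | ∃ n, t = rn n}
  lower' := by
    rintro _ t ht ⟨n, rfl⟩
    rcases t.cases with h | ⟨m, h, rfl⟩ | rfl
    · exact h
    · simp at ht
    · simp at ht

@[simp] theorem rn_mem_ladder (n : ℕ) : rn n ∈ ladder := ⟨n, rfl⟩

@[simp] theorem mid_notMem_ladder (n : ℕ) (h) : mid n h ∉ ladder := by
  rintro ⟨m, hm⟩
  exact not_mid_le_rn hm.le

@[simp] theorem root_notMem_ladder : root ∉ ladder := by
  rintro ⟨m, hm⟩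
  exact not_root_le_rn hm.le

/-! ### Implications between principal lower sets -/

theorem compl_Iic_rn {a b : ℕ} (h : (a = 0 ∧ b = 1) ∨ (a = 1 ∧ b = 2)) :
    (LowerSet.Iic (rn a))ᶜ = LowerSet.Iic (rn b) := by
  ext t
  rw [← himp_bot, SetLike.mem_coe, SetLike.mem_coe, mem_Iic_himp_lowerSet, LowerSet.mem_Iic_iff]
  · rcases t.cases with ⟨n, rfl⟩ | ⟨n, h, rfl⟩ | rfl
    · simp; omega
    · simp
    · simp
  · intro s hs
    rcases s.cases with ⟨n, rfl⟩ | ⟨n, h, rfl⟩ | rfl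
    · have h1 := hs.le
      have h2 := hs.not_ge
      simp at h1 h2
      omega
    · exact absurd hs.le not_mid_le_rn
    · exact absurd hs.le not_root_le_rn
  · exact fun h => h

theorem himp_ladder {a b : ℕ} (ha hb) (h : (a = 0 ∧ b = 1) ∨ (a = 1 ∧ b = 2)) :
    LowerSet.Iic (mid a ha) ⇨ ladder = LowerSet.Iic (mid b hb) := by
  ext t
  rw [SetLike.mem_coe, SetLike.mem_coe, mem_Iic_himp_lowerSet, LowerSet.mem_Iic_iff]
  · rcases t.cases with ⟨n, rfl⟩ | ⟨n, h, rfl⟩ | rfl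
    · simp
    · simp; omega
    · simp
  · intro s hs
    rcases s.cases with ⟨n, rfl⟩ | ⟨n, h, rfl⟩ | rfl
    · simp
    · have h1 := hs.le
      have h2 := hs.not_ge
      simp at h1 h2
      omega
    · exact absurd hs.le not_root_le_mid
  · simp

theorem himp_Iic_rn (n : ℕ) :
    LowerSet.Iic (rn (n + 2)) ⇨ (LowerSet.Iic (rn n) ⊔ LowerSet.Iic (rn (n + 1))) =
      LowerSet.Iic (rn (n + 3)) := by
  ext t
  rw [SetLike.mem_coe, SetLike.mem_coe, mem_Iic_himp_lowerSet, LowerSet.mem_Iic_iff]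
  · rcases t.cases with ⟨n, rfl⟩ | ⟨n, h, rfl⟩ | rfl
    · simp; omega
    · simp
    · simp
  · intro s hs
    rcases s.cases with ⟨n, rfl⟩ | ⟨n, h, rfl⟩ | rfl
    · have h1 := hs.le
      have h2 := hs.not_ge
      simp at h1 h2
      simp [LowerSet.mem_sup_iff]
      omega
    · exact absurd hs.le not_mid_le_rn
    · exact absurd hs.le not_root_le_rn
  · simp [LowerSet.mem_sup_iff]
    omega

/-- A valuation that refutes the pre-true formula. -/
def kgVal : ℕ → LowerSet KGFrame
  | 0 => LowerSet.Iic (rn 0)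
  | 1 => ladder
  | 2 => LowerSet.Iic (mid 0 (by simp))
  | _ => LowerSet.Iic (mid 4 (by simp))

theorem kgPremise_eval_kgVal : kgPremise.eval kgVal = ⊤ := by
  simp only [kgPremise, Formula.relNeg, Formula.eval, kgVal,
    compl_Iic_rn (a := 0) (b := 1) (by simp), compl_Iic_rn (a := 1) (b := 2) (by simp),
    himp_ladder (a := 0) (b := 1) (by simp) (by simp) (by simp),
    himp_ladder (a := 1) (b := 2) (by simp) (by simp) (by simp), inf_eq_top_iff, himp_eq_top_iff]
  refine ⟨⟨⟨⟨⟨?_, ?_⟩, ?_⟩, ?_⟩, ?_⟩, ?_⟩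
  all_goals
    intro t ht
    rcases t.cases with ⟨n, rfl⟩ | ⟨n, h, rfl⟩ | rfl
  · simp
  · simp at ht
  · simp at ht
  · simp
  · have := mem_himp_lowerSet.1 ht (rn 2) rn_le_mid
    simp at this
  · have := mem_himp_lowerSet.1 ht (rn 2) le_root
    simp at this
  · simp
  · simp at ht
  · simp at ht
  · simp
  · have := mem_himp_lowerSet.1 ht (mid 2 (by simp))
    simp at this
    simp
    omega
  · have := mem_himp_lowerSet.1 ht (mid 2 (by simp)) le_root
    simp at this
  · simp
  · simp at ht ⊢
    omega
  · simp at ht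
  · simp
  · have := mem_himp_lowerSet.1 ht (mid 4 (by simp))
    simp [LowerSet.mem_sup_iff] at this ⊢
    omega
  · have := mem_himp_lowerSet.1 ht (mid 4 (by simp)) le_root
    simp [LowerSet.mem_sup_iff] at this

/-! ### Analysis of the refutations -/

theorem rn_zero_le_or_eq (t : KGFrame) : rn 0 ≤ t ∨ t = rn 1 := by
  rcases t.cases with ⟨n, rfl⟩ | ⟨n, h, rfl⟩ | rfl
  · by_cases hn : n = 1
    · exact Or.inr (hn ▸ rfl)
    · left
      simp
      omega
  · simp
  · simp

theorem rn_one_le_or (t : KGFrame) : rn 1 ≤ t ∨ t = rn 0 ∨ t = rn 2 := by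
  rcases t.cases with ⟨n, rfl⟩ | ⟨n, h, rfl⟩ | rfl
  · by_cases hn : n = 0
    · exact Or.inr (Or.inl (hn ▸ rfl))
    by_cases hn : n = 2
    · exact Or.inr (Or.inr (hn ▸ rfl))
    · left
      simp
      omega
  · simp
  · simp

/-- A refutation of the pre-true formula takes place at the root, below a copy of the frame of `Z₇`
that is given by the relative negations of `p₂`. -/
theorem eq_root_of_refutes {c p np nnp q : LowerSet KGFrame} {w : KGFrame}
    (hnp : np = p ⇨ c) (hnnp : nnp = np ⇨ c) (hq : w ∉ q)
    (h3 : ∀ t ≤ w, t ∈ c → t ∈ p)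
    (h4 : ∀ t ≤ w, t ∈ nnp ⇨ p → t ∈ p ∨ t ∈ np)
    (h5 : ∀ t ≤ w, t ∈ nnp ∨ t ∈ np → t ∈ q)
    (h6 : ∀ t ≤ w, t ∈ q ⇨ (nnp ⊔ np) → t ∈ nnp ∨ t ∈ np) :
    w = root ∧ mid 4 (by simp) ∈ q ∧ mid 0 (by simp) ∈ p ∧ mid 0 (by simp) ∉ c ∧
      mid 1 (by simp) ∉ p ∧ mid 1 (by simp) ∉ c ∧ mid 2 (by simp) ∉ p ∧ ∀ n, rn n ∈ c := by
  have np_p : ∀ t, t ∈ np → t ∈ p → t ∈ c := fun t ht hp => by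
    rw [hnp, mem_himp_lowerSet] at ht
    exact ht t le_rfl hp
  have nnp_np : ∀ t, t ∈ nnp → t ∈ np → t ∈ c := fun t ht hp => by
    rw [hnnp, mem_himp_lowerSet] at ht
    exact ht t le_rfl hp
  have not_np : ∀ t, t ∉ np → ∃ s ≤ t, s ∈ p ∧ s ∉ c := fun t ht => by
    rw [hnp, mem_himp_lowerSet] at ht
    push Not at ht
    exact ht
  have not_nnp : ∀ t, t ∉ nnp → ∃ s ≤ t, s ∈ np ∧ s ∉ c := fun t ht => by
    rw [hnnp, mem_himp_lowerSet] at ht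
    push Not at ht
    exact ht
  have hwnp : ¬ (w ∈ nnp ∨ w ∈ np) := fun h => hq (h5 w le_rfl h)
  obtain ⟨u, huw, huq, hu⟩ : ∃ u ≤ w, u ∈ q ∧ ¬ (u ∈ nnp ∨ u ∈ np) := by
    have : w ∉ q ⇨ (nnp ⊔ np) := fun h => hwnp (h6 w le_rfl h)
    rw [mem_himp_lowerSet] at this
    push Not at this
    exact this
  have hne : u ≠ w := fun h => hq (h ▸ huq)
  rw [not_or] at hu
  obtain ⟨y, hyu, hynp, hyc⟩ := not_nnp u hu.1
  have hup : u ∉ p := fun h => hyc (np_p y hynp (p.lower hyu h))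
  obtain ⟨z, hzu, hznnp, hzp⟩ : ∃ z ≤ u, z ∈ nnp ∧ z ∉ p := by
    have : u ∉ nnp ⇨ p := fun h => (h4 u huw h).elim hup hu.2
    rw [mem_himp_lowerSet] at this
    push Not at this
    exact this
  have hznp : z ∉ np := fun h => hzp (h3 z (hzu.trans huw) (nnp_np z hznnp h))
  obtain ⟨x, hxz, hxp, hxc⟩ := not_np z hznp
  -- Now `x < z`, `y` is incomparable with both, and `u` sees all three: the shape of the frame of
  -- `Z₇`.
  have hxz' : x ≠ z := fun h => hzp (h ▸ hxp)
  have hyz : ¬ y ≤ z := fun h => hyc (nnp_np y (nnp.lower h hznnp) hynp)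
  have hxy : ¬ x ≤ y := fun h => hxc (np_p x (np.lower h hynp) hxp)
  have hzy : ¬ z ≤ y := fun h => hxy (hxz.trans h)
  have hyp : y ∉ p := fun h => hyc (np_p y hynp h)
  have hyx : ¬ y ≤ x := fun h => hyz (h.trans hxz)
  rcases y.cases with ⟨j, rfl⟩ | ⟨j, hj, rfl⟩ | rfl
  · exfalso
    rcases z.cases with ⟨i, rfl⟩ | ⟨i, hi, rfl⟩ | rfl
    · rcases x.cases with ⟨k, rfl⟩ | ⟨k, hk, rfl⟩ | rfl
      · have hki : k ≠ i := fun h => hxz' (h ▸ rfl)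
        simp only [rn_le_rn, not_or, not_le] at hxz hyz hxy hzy hyx
        obtain rfl : i = j + 1 := by omega
        obtain rfl : j = k + 1 := by omega
        -- In the ladder, `x`, `y`, `z` are `w_k`, `w_{k+1}`, `w_{k+2}`, and `w_{k+3}` violates
        -- `h4`. The point `w`, strictly above `u`, sees it; the frame of `Z₇` has no `w₃`, so there
        -- the obstruction is absent.
        have htw : rn (k + 3) ≤ w := by
          rcases w.cases with ⟨l, rfl⟩ | ⟨l, hl, rfl⟩ | rfl
          · rcases u.cases with ⟨l', rfl⟩ | ⟨l', hl', rfl⟩ | rfl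
            · have : l' ≠ l := fun h => hne (h ▸ rfl)
              simp only [rn_le_rn] at hyu hzu huw ⊢
              omega
            · exact absurd huw not_mid_le_rn
            · exact absurd huw not_root_le_rn
          · exact rn_le_mid
          · exact le_root
        have ht : rn (k + 3) ∈ nnp ⇨ p := by
          rw [mem_himp_lowerSet]
          intro s hs hsn
          rcases s.cases with ⟨l, rfl⟩ | ⟨l, hl, rfl⟩ | rfl
          · have hyl : ¬ rn (k + 1) ≤ rn l := fun h =>
              hyc (nnp_np _ (nnp.lower h hsn) hynp)
            rw [rn_le_rn] at hs hyl
            by_cases hl : l + 1 = k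
            · refine h3 _ ((rn_le_rn.2 hs).trans htw) (nnp_np _ hsn (np.lower (rn_le_rn.2 ?_) hynp))
              omega
            · refine p.lower (rn_le_rn.2 ?_) hxp
              omega
          · exact absurd hs not_mid_le_rn
          · exact absurd hs not_root_le_rn
        rcases h4 _ htw ht with h | h
        · exact hyp (p.lower (rn_le_rn.2 (Or.inr le_rfl)) h)
        · exact hxc (np_p _ (np.lower (rn_le_rn.2 (by omega)) h) hxp)
      · exact not_mid_le_rn hxz
      · exact not_root_le_rn hxz
    · exact hyz rn_le_mid
    · exact hyz le_root
  · rcases z.cases with ⟨i, rfl⟩ | ⟨i, hi, rfl⟩ | rfl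
    · exact absurd rn_le_mid hzy
    · rcases x.cases with ⟨k, rfl⟩ | ⟨k, hk, rfl⟩ | rfl
      · exact absurd rn_le_mid hxy
      · have hki : k ≠ i := fun h => hxz' (by subst h; rfl)
        simp only [mid_le_mid, not_or, not_le] at hxz hyz hxy hzy hyx
        obtain rfl : i = 2 := by omega
        obtain rfl : j = 1 := by omega
        obtain rfl : k = 0 := by omega
        have hu4 : u = root ∨ u = mid 4 (by simp) := by
          rcases u.cases with ⟨l, rfl⟩ | ⟨l, hl, rfl⟩ | rfl
          · exact absurd hyu not_mid_le_rn
          · simp only [mid_le_mid] at hyu hzu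
            obtain rfl : l = 4 := by omega
            exact Or.inr rfl
          · exact Or.inl rfl
        rcases hu4 with rfl | rfl
        · exact absurd (root_le_iff.1 huw).symm hne
        have hw : w = root := by
          rcases w.cases with ⟨l, rfl⟩ | ⟨l, hl, rfl⟩ | rfl
          · exact absurd huw not_mid_le_rn
          · rw [mid_le_mid] at huw
            obtain rfl : l = 4 := by omega
            exact absurd rfl hne
          · rfl
        exact ⟨hw, huq, hxp, hxc, hyp, hyc, hzp, fun n =>
          np_p _ (np.lower rn_le_mid hynp) (p.lower rn_le_mid hxp)⟩
      · exact absurd hxz not_root_le_mid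
    · exact absurd le_root hyz
  · exact absurd le_root hzy

theorem lowerSet_eq_Iic {s : LowerSet KGFrame} {a : KGFrame} (ha : a ∈ s)
    (h : ∀ t, ¬ t ≤ a → t ∉ s) : s = LowerSet.Iic a :=
  le_antisymm (fun t ht => by_contra fun h' => h t h' ht) (LowerSet.Iic_le.2 ha)

/-- The values of the variables in a refutation of the pre-true formula are determined. -/
theorem eq_kgVal_of_refutes {v : ℕ → LowerSet KGFrame} {w : KGFrame} (hA : w ∈ kgPremise.eval v)
    (hq : w ∉ v 3) : w = root ∧ ∀ i < 4, v i = kgVal i := by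
  simp only [kgPremise, Formula.relNeg, Formula.eval, LowerSet.mem_inf_iff] at hA
  obtain ⟨⟨⟨⟨⟨h1, h2⟩, h3⟩, h4⟩, h5⟩, h6⟩ := hA
  rw [mem_himp_lowerSet] at h1 h2 h3 h4 h5 h6
  obtain ⟨rfl, q4, p0, c0, p1, c1, p2, hc⟩ := eq_root_of_refutes rfl rfl hq h3 h4 h5 h6
  refine ⟨rfl, ?_⟩
  have e1 : v 1 = ladder := by
    ext t
    rcases t.cases with ⟨n, rfl⟩ | ⟨n, h, rfl⟩ | rfl
    · simp [hc]
    · simp only [SetLike.mem_coe, mid_notMem_ladder, iff_false]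
      intro ht
      by_cases hn : n = 1
      · subst hn
        exact c1 ht
      · exact c0 ((v 1).lower (mid_le_mid.2 (by omega)) ht)
    · simp only [SetLike.mem_coe, root_notMem_ladder, iff_false]
      exact fun ht => c0 ((v 1).lower le_root ht)
  have e2 : v 2 = LowerSet.Iic (mid 0 (by simp)) := by
    refine lowerSet_eq_Iic p0 fun t ht htp => ?_
    rcases t.cases with ⟨n, rfl⟩ | ⟨n, h, rfl⟩ | rfl
    · exact ht rn_le_mid
    · rw [mid_le_mid] at ht
      by_cases hn : n = 2
      · subst hn
        exact p2 htp
      · exact p1 ((v 2).lower (mid_le_mid.2 (by omega)) htp)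
    · exact p1 ((v 2).lower le_root htp)
  have e3 : v 3 = LowerSet.Iic (mid 4 (by simp)) := by
    refine lowerSet_eq_Iic q4 fun t ht htp => ?_
    rcases t.cases with ⟨n, rfl⟩ | ⟨n, h, rfl⟩ | rfl
    · exact ht rn_le_mid
    · rw [mid_le_mid] at ht
      omega
    · exact hq htp
  have e0 : v 0 = LowerSet.Iic (rn 0) := by
    have hr : root ∉ (v 0)ᶜ ⊔ (v 0)ᶜᶜ := fun h => root_notMem_ladder (e1 ▸ h1 root le_rfl h)
    rw [LowerSet.mem_sup_iff, not_or, mem_compl_lowerSet, mem_compl_lowerSet] at hr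
    obtain ⟨ha, hb⟩ := hr
    push Not at ha hb
    obtain ⟨a, -, ha⟩ := ha
    obtain ⟨b, -, hb⟩ := hb
    rw [mem_compl_lowerSet] at hb
    obtain ⟨t, htnn, htn⟩ : ∃ t, t ∈ (v 0)ᶜᶜ ∧ t ∉ v 0 := by
      have : root ∉ (v 0)ᶜᶜ ⇨ v 0 := fun h => root_notMem_ladder (e1 ▸ h2 root le_rfl h)
      rw [mem_himp_lowerSet] at this
      push Not at this
      obtain ⟨t, -, ht⟩ := this
      exact ⟨t, ht⟩
    rw [mem_compl_lowerSet] at htnn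
    -- Exactly one of the minimal points `w₀`, `w₁` is in `v 0`. If it is `w₁`, then `v 0` is
    -- regular, against the second conjunct; if it is `w₀`, non-regularity excludes `w₂` and leaves
    -- only `{w₀}`.
    rcases rn_zero_le_or_eq a with ha0 | rfl
    · have h0 : rn 0 ∈ v 0 := (v 0).lower ha0 ha
      have hb1 : b = rn 1 := (rn_zero_le_or_eq b).resolve_left fun h => hb _ h h0
      subst hb1
      have h1 : rn 1 ∉ v 0 := hb _ le_rfl
      have ht : ¬ rn 1 ≤ t := fun h => htnn _ h (mem_compl_lowerSet.2 hb)
      rcases (rn_one_le_or t).resolve_left ht with rfl | rfl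
      · exact absurd h0 htn
      · refine lowerSet_eq_Iic h0 fun s hs hsv => ?_
        rcases rn_one_le_or s with h | rfl | rfl
        · exact h1 ((v 0).lower h hsv)
        · exact hs le_rfl
        · exact htn hsv
    · have hb0 : rn 0 ∉ v 0 := by
        rcases rn_zero_le_or_eq b with h | rfl
        · exact hb _ h
        · exact absurd ha (hb _ le_rfl)
      rcases rn_zero_le_or_eq t with h | rfl
      · refine absurd (mem_compl_lowerSet.2 fun s hs hsv => ?_) (htnn _ h)
        rcases rn_zero_le_or_eq s with h' | rfl
        · exact hb0 ((v 0).lower h' hsv)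
        · simp at hs
      · exact absurd ha htn
  intro i hi
  interval_cases i
  · exact e0
  · exact e1
  · exact e2
  · exact e3

/-- All principal lower sets are generated, those of the ladder recursively. A lower set omitting
some `w_n` of the ladder is finite; any other is the ladder together with finitely many points. -/
theorem IsSubalgebra.eq_univ_of_kgVal {S : Set (LowerSet KGFrame)} (hS : IsSubalgebra S)
    (h : ∀ i < 4, kgVal i ∈ S) : S = Set.univ := by
  have hrn : ∀ n, LowerSet.Iic (rn n) ∈ S ∧ LowerSet.Iic (rn (n + 1)) ∈ S ∧
      LowerSet.Iic (rn (n + 2)) ∈ S := by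
    intro n
    induction n with
    | zero =>
      have h0 : LowerSet.Iic (rn 0) ∈ S := h 0 (by simp)
      have h1 : LowerSet.Iic (rn 1) ∈ S := by
        rw [← compl_Iic_rn (a := 0) (by simp)]
        exact hS.compl_mem _ h0
      refine ⟨h0, h1, ?_⟩
      rw [← compl_Iic_rn (a := 1) (by simp)]
      exact hS.compl_mem _ h1
    | succ n ih =>
      refine ⟨ih.2.1, ih.2.2, ?_⟩
      rw [← himp_Iic_rn]
      exact hS.himp_mem _ ih.2.2 _ (hS.sup_mem _ ih.1 _ ih.2.1)
  have hc : ladder ∈ S := h 1 (by simp)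
  have h0 : LowerSet.Iic (mid 0 (by simp)) ∈ S := h 2 (by simp)
  have h1 : LowerSet.Iic (mid 1 (by simp)) ∈ S := by
    rw [← himp_ladder (a := 0) (by simp) _ (by simp)]
    exact hS.himp_mem _ h0 _ hc
  have h2 : LowerSet.Iic (mid 2 (by simp)) ∈ S := by
    rw [← himp_ladder (a := 1) (by simp) _ (by simp)]
    exact hS.himp_mem _ h1 _ hc
  have h4 : LowerSet.Iic (mid 4 (by simp)) ∈ S := h 3 (by simp)
  have hprin : ∀ t, LowerSet.Iic t ∈ S := by
    intro t
    rcases t.cases with ⟨n, rfl⟩ | ⟨n, hn, rfl⟩ | rfl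
    · exact (hrn n).1
    · obtain rfl | rfl | rfl | rfl : n = 0 ∨ n = 1 ∨ n = 2 ∨ n = 4 := by omega
      · exact h0
      · exact h1
      · exact h2
      · exact h4
    · have : LowerSet.Iic root = ⊤ := top_le_iff.1 fun t _ => le_root
      rw [this]
      exact hS.top_mem
  have hfin : ∀ T : Set KGFrame, T.Finite → ∃ s ∈ S, (∀ t ∈ T, t ∈ s) ∧
      ∀ x : LowerSet KGFrame, (∀ t ∈ T, t ∈ x) → s ≤ x := by
    intro T hT
    induction T, hT using Set.Finite.induction_on with
    | empty => exact ⟨⊥, hS.bot_mem, by simp, fun _ _ => bot_le⟩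
    | insert _ _ ih =>
      rename_i a T _ _
      obtain ⟨s, hsS, hs, hs'⟩ := ih
      refine ⟨LowerSet.Iic a ⊔ s, hS.sup_mem _ (hprin a) _ hsS, ?_, fun x hx => ?_⟩
      · rintro t (rfl | ht)
        · exact Or.inl (LowerSet.mem_Iic_iff.2 le_rfl)
        · exact Or.inr (hs t ht)
      · exact sup_le (LowerSet.Iic_le.2 (hx a (by simp))) (hs' x fun t ht => hx t (by simp [ht]))
  refine Set.eq_univ_of_forall fun x => ?_
  have hmid : {t | t ∉ ladder}.Finite := by
    refine (Set.toFinite {mid 0 (by simp), mid 1 (by simp), mid 2 (by simp), mid 4 (by simp),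
      root}).subset fun t ht => ?_
    rcases t.cases with ⟨n, rfl⟩ | ⟨n, hn, rfl⟩ | rfl
    · exact absurd (rn_mem_ladder n) ht
    · obtain rfl | rfl | rfl | rfl : n = 0 ∨ n = 1 ∨ n = 2 ∨ n = 4 := by omega
      all_goals simp
    · simp
  by_cases hx : ladder ≤ x
  · obtain ⟨s, hsS, hs, hs'⟩ := hfin {t | t ∈ x ∧ t ∉ ladder} (hmid.subset fun t ht => ht.2)
    have : x = ladder ⊔ s := by
      refine le_antisymm (fun t ht => ?_) (sup_le hx (hs' x fun t ht => ht.1))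
      by_cases htl : t ∈ ladder
      · exact Or.inl htl
      · exact Or.inr (hs t ⟨ht, htl⟩)
    rw [this]
    exact hS.sup_mem _ hc _ hsS
  · obtain ⟨_, ⟨n, rfl⟩, hn⟩ := Set.not_subset.1 hx
    have hxfin : {t | t ∈ x}.Finite := by
      refine ((Set.finite_Iic (n + 1)).image rn).subset fun t ht => ?_
      have hnt : ¬ rn n ≤ t := fun h => hn (x.lower h ht)
      rcases t.cases with ⟨m, rfl⟩ | ⟨m, h, rfl⟩ | rfl
      · rw [rn_le_rn] at hnt
        exact ⟨m, by simp only [Set.mem_Iic]; omega, rfl⟩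
      · exact absurd rn_le_mid hnt
      · exact absurd le_root hnt
    obtain ⟨s, hsS, hs, hs'⟩ := hfin _ hxfin
    rwa [le_antisymm (fun t ht => hs t ht) (hs' x fun t ht => ht)]

theorem eq_root_and_eq_kgVal_of_refutes {v : ℕ → LowerSet KGFrame} {w : KGFrame}
    (h : w ∉ kgPreTrue.eval v) : w = root ∧ ∀ i < 4, v i = kgVal i := by
  have h' : ∃ u ≤ w, u ∈ kgPremise.eval v ∧ u ∉ v 3 := by
    rw [kgPreTrue, Formula.eval, mem_himp_lowerSet] at h
    push Not at h
    exact h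
  obtain ⟨u, huw, hA, hq⟩ := h'
  obtain ⟨rfl, hv⟩ := eq_kgVal_of_refutes hA hq
  exact ⟨root_le_iff.1 huw, hv⟩

theorem preTrue_kgPreTrue : PreTrue kgPreTrue KGAlgebra where
  not_valid h := by
    have h1 := h.of_surjective kgHom kgIso.surjective kgVal
    rw [kgPreTrue, Formula.eval, kgPremise_eval_kgVal, top_himp] at h1
    have h2 : root ∈ kgVal 3 :=
      (show kgVal 3 = ⊤ from h1) ▸ (trivial : root ∈ (⊤ : LowerSet KGFrame))
    exact not_root_le_mid h2
  valid_subalgebra S hS hne v hv := by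
    by_contra hF
    obtain ⟨w, hw⟩ : ∃ w, w ∉ kgHom (kgPreTrue.eval v) := by
      by_contra! h
      exact hF (kgIso.injective ((top_le_iff.1 fun w _ => h w).trans (map_top kgIso).symm))
    rw [Formula.map_eval] at hw
    obtain ⟨-, hv'⟩ := eq_root_and_eq_kgVal_of_refutes hw
    refine hne (Set.eq_univ_of_forall fun x => ?_)
    have h1 : IsSubalgebra {s | kgSymmHom s ∈ S} := hS.comap kgSymmHom
    have h2 := h1.eq_univ_of_kgVal fun i hi => by
      rw [← hv' i hi]
      change kgIso.symm (kgIso (v i)) ∈ S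
      rw [kgIso.symm_apply_apply]
      exact hv i
    have h3 : kgIso.symm (kgIso x) ∈ S := h2.ge (Set.mem_univ (kgIso x))
    rwa [kgIso.symm_apply_apply] at h3
  valid_image B _ f hf hinj v := by
    choose g hg using hf
    have h1 := Formula.map_eval f (fun i => g (v i)) kgPreTrue
    simp only [hg] at h1
    rw [← h1]
    by_contra hF
    apply hinj
    -- A value different from `⊤` omits the root alone, so it is the opremum.
    refine HeytingHom.injective_of_opremum (a := kgPreTrue.eval fun i => g (v i))
      ⟨fun h => hF (h ▸ map_top f), fun x hx => ?_⟩ hF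
    rw [← kgIso.le_iff_le]
    intro w hwx
    by_contra hw
    have hw' : w ∉ kgHom (kgPreTrue.eval fun i => g (v i)) := hw
    rw [Formula.map_eval] at hw'
    obtain ⟨rfl, -⟩ := eq_root_and_eq_kgVal_of_refutes hw'
    refine hx (kgIso.injective ((top_le_iff.1 fun t _ => ?_).trans (map_top kgIso).symm))
    exact (kgIso x).lower le_root hwx

/-! ### Characteristic formulas that are refuted in the Kuznetsov-Gerčiu algebra -/

theorem PreTrue.valid_of_injective {F : Formula} {H H' : Type} [HeytingAlgebra H]
    [HeytingAlgebra H'] (hF : PreTrue F H) [Infinite H] [Finite H'] (f : HeytingHom H' H)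
    (hf : Function.Injective f) : Valid H' F := by
  intro v
  apply hf
  rw [Formula.map_eval, map_top]
  refine hF.valid_subalgebra _ (.range f) (fun h => ?_) _ fun i => ⟨v i, rfl⟩
  exact Set.infinite_univ (h ▸ Set.finite_range f)

/-- The embedding of the two-element algebra. -/
def boolHom (H : Type*) [HeytingAlgebra H] : HeytingHom Bool H where
  toFun b := bif b then ⊤ else ⊥
  map_sup' := by rintro (_ | _) (_ | _) <;> simp
  map_inf' := by rintro (_ | _) (_ | _) <;> simp
  map_bot' := rfl
  map_himp' := by
    rintro (_ | _) (_ | _)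
    · exact himp_self.symm
    · exact himp_top.symm
    · exact top_himp.symm
    · exact himp_self.symm

theorem boolHom_injective (H : Type*) [HeytingAlgebra H] [Nontrivial H] :
    Function.Injective (boolHom H) := by
  have h : (⊥ : H) ≠ ⊤ := bot_ne_top
  rintro (_ | _) (_ | _) hab
  · rfl
  · exact absurd hab h
  · exact absurd hab h.symm
  · rfl

theorem Defines.mono {V W : Set Formula} (h : V ⊆ Logic W) {H : Type} [HeytingAlgebra H]
    {P : Finset ℕ} {A : Formula} {ν : ℕ → H} (hD : Defines V P A ν) : Defines W P A ν :=
  { hD with complete := fun B hB hν => Logic_anti h (hD.complete B hB hν) }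

/-- Let `F` be pre-true in an infinite algebra `K` of the variety `KG`. A characteristic formula over
a variety that contains `K` is valid in `K` if it follows from `F` over `KG`. -/
theorem IsCharFormula.valid_of_preTrue {K : Type} [HeytingAlgebra K] [Infinite K]
    (hKG : Valid K kgAxiom) {F : Formula} (hF : PreTrue F K) {V : Set Formula} (hV : Mem V K)
    {χ : Formula} (hχ : IsCharFormula V χ) (h : χ ∈ Logic {kgAxiom, F}) : Valid K χ := by
  obtain ⟨H, _, P, A, B, ν, hH, hSI, hD, hB, hop, rfl⟩ := hχ
  intro v
  by_contra hv
  set a := A.eval v with ha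
  have hQ := hV.of_surjective (iicHom a) (iicHom_surjective a)
  obtain ⟨f, hf⟩ := hD.exists_hom hQ (fun i => iicHom a (v i))
    ((Formula.map_eval (iicHom a) v A).symm.trans (iicHom_eq_top.2 le_rfl))
  have hinj : Function.Injective f := by
    refine HeytingHom.injective_of_opremum hop fun h => hv ?_
    rw [hf B hB, ← Formula.map_eval, iicHom_eq_top] at h
    rw [Formula.eval, himp_eq_top_iff]
    exact h
  have hHKG : Valid H kgAxiom :=
    (hKG.of_surjective (iicHom a) (iicHom_surjective a)).of_injective f hinj
  -- The variety of `V` need not lie in `KG`; adding the axiom keeps both `H` and its presentation.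
  have hfin : Finite H := finite_of_finitelyPresentable (V := insert kgAxiom V)
    (subset_Logic _ (Set.mem_insert _ _))
    (by
      rintro C (rfl | hC)
      · exact hHKG
      · exact hH C hC)
    hSI ⟨P, A, ν, hD.mono ((Set.subset_insert _ _).trans (subset_Logic _))⟩
  have hHF : Valid H F := by
    by_cases hat : a = ⊤
    · obtain ⟨g, hg⟩ := hD.exists_hom hV v hat
      refine hF.valid_of_injective g (HeytingHom.injective_of_opremum hop fun h => hv ?_)
      rw [Formula.eval, ← hg B hB, h, himp_top]
    · exact (hF.valid_image _ (iicHom a) (iicHom_surjective a)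
        (iicHom_not_injective hat)).of_injective f hinj
  have := h H (by rintro C (rfl | rfl) <;> assumption) ν
  rw [Formula.eval, hD.eval_eq_top, top_himp] at this
  exact hop.1 this

/-- Every stage of the construction stays inside the final logic. By induction `K` validates the
stage reached, so the varieties used next contain `K` and the transfer principle applies. -/
theorem Mem.of_charAxiomatizable {K : Type} [HeytingAlgebra K] [Infinite K] (hKG : Valid K kgAxiom)
    {F : Formula} (hF : PreTrue F K) {L : Set Formula} (hL : CharAxiomatizable L)
    (h : L ⊆ Logic {kgAxiom, F}) : Mem L K := by
  induction hL with
  | intuitionistic => exact Mem_Logic (by rintro A ⟨⟩)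
  | adjoin L G _ hG ih =>
    have hL := ih ((Set.subset_union_left.trans (subset_Logic _)).trans h)
    refine Mem_Logic ?_
    rintro χ (hχ | hχ)
    · exact hL χ hχ
    · obtain ⟨V, hVL, hV⟩ := hG χ hχ
      exact hV.valid_of_preTrue hKG hF (fun A hA => hL A (hVL hA))
        (h (subset_Logic _ (Or.inr hχ)))
  | join L _ ih =>
    refine Mem_Logic fun A hA => ?_
    obtain ⟨i, hi⟩ := Set.mem_iUnion.1 hA
    exact ih i (((Set.subset_iUnion L i).trans (subset_Logic _)).trans h) A hi

/-! ### Jankov formulas -/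

theorem bigAnd_eval_eq_top {H : Type*} [HeytingAlgebra H] {v : ℕ → H} :
    ∀ l : List Formula, (bigAnd l).eval v = ⊤ ↔ ∀ A ∈ l, A.eval v = ⊤
  | [] => by simp [bigAnd, Formula.eval]
  | [A] => by simp [bigAnd]
  | A :: B :: l => by
    rw [bigAnd, Formula.eval, inf_eq_top_iff, bigAnd_eval_eq_top (B :: l),
      List.forall_mem_cons (a := A)]

theorem bigAnd_vars_subset {P : Finset ℕ} (h0 : 0 ∈ P) :
    ∀ l : List Formula, (∀ A ∈ l, A.vars ⊆ P) → (bigAnd l).vars ⊆ P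
  | [], _ => by simpa [bigAnd, Formula.vars] using h0
  | [A], h => h A (by simp)
  | A :: B :: l, h => Finset.union_subset (h A (by simp))
      (bigAnd_vars_subset h0 (B :: l) fun C hC => h C (by simp [hC]))

theorem diagram_eval_eq_top {H H' : Type} [HeytingAlgebra H] [HeytingAlgebra H'] {n : ℕ}
    (e : H ≃ Fin n) {v : ℕ → H'} : (diagram e).eval v = ⊤ ↔
      (∀ a b, v (e a) ⊓ v (e b) = v (e (a ⊓ b))) ∧ (∀ a b, v (e a) ⊔ v (e b) = v (e (a ⊔ b))) ∧
      (∀ a b, v (e a) ⇨ v (e b) = v (e (a ⇨ b))) ∧ ∀ a, (v (e a))ᶜ = v (e aᶜ) := by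
  rw [diagram, bigAnd_eval_eq_top]
  simp only [List.forall_mem_append, List.forall_mem_flatMap, List.forall_mem_map,
    List.mem_finRange, forall_const, Formula.eval_iff_eq_top, Formula.eval, and_assoc]
  refine and_congr ?_ (and_congr ?_ (and_congr ?_ ?_))
  · exact ⟨fun h a b => by simpa using h (e a) (e b), fun h i j => by
      simpa using h (e.symm i) (e.symm j)⟩
  · exact ⟨fun h a b => by simpa using h (e a) (e b), fun h i j => by
      simpa using h (e.symm i) (e.symm j)⟩
  · exact ⟨fun h a b => by simpa using h (e a) (e b), fun h i j => by
      simpa using h (e.symm i) (e.symm j)⟩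
  · exact ⟨fun h a => by simpa using h (e a), fun h i => by simpa using h (e.symm i)⟩

theorem diagram_vars_subset {H : Type} [HeytingAlgebra H] {n : ℕ} (e : H ≃ Fin n) :
    (diagram e).vars ⊆ Finset.range n := by
  refine bigAnd_vars_subset (Finset.mem_range.2 (e ⊥).pos) _ ?_
  simp only [List.forall_mem_append, List.forall_mem_flatMap, List.forall_mem_map,
    List.mem_finRange, forall_const, Formula.iff, Formula.vars]
  refine ⟨⟨⟨?_, ?_⟩, ?_⟩, ?_⟩ <;> intros <;>
    simp [Finset.insert_subset_iff]

/-- The diagram formula of a finite algebra defines it over the variety of all algebras. -/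
theorem defines_diagram {H : Type} [HeytingAlgebra H] {n : ℕ} (e : H ≃ Fin n) {ν : ℕ → H}
    (hν : ∀ a, ν (e a) = a) : Defines ∅ (Finset.range n) (diagram e) ν where
  vars_subset := diagram_vars_subset e
  generates S _ h := Set.eq_univ_of_forall fun a => by
    rw [← hν a]
    exact h _ (Finset.mem_range.2 (e a).2)
  eval_eq_top := (diagram_eval_eq_top e).2 (by simp [hν])
  complete B hB hBν H' _ _ v := by
    rw [Formula.eval, himp_eq_top_iff, ← iicHom_eq_top, Formula.map_eval]
    -- In `[⊥, D]` the diagram is true, so its equations turn the assignment of variables to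
    -- elements into a homomorphism from `H`.
    set D := (diagram e).eval v with hD
    obtain ⟨hinf, hsup, himp, hcompl⟩ := (diagram_eval_eq_top e).1
      ((Formula.map_eval (iicHom D) v (diagram e)).symm.trans (iicHom_eq_top.2 le_rfl))
    -- The diagram has no clauses for constants; they are recovered as `1 = 0 ⇨ 0` and `0 = 1ᶜ`.
    have htop : iicHom D (v (e ⊤)) = ⊤ := by
      rw [← himp_self (a := (⊥ : H)), ← himp, himp_self]
    let f : HeytingHom H (Set.Iic D) :=
      { toFun := fun a => iicHom D (v (e a))
        map_sup' := fun a b => (hsup a b).symm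
        map_inf' := fun a b => (hinf a b).symm
        map_bot' := by
          change iicHom D (v (e ⊥)) = ⊥
          rw [← compl_top, ← hcompl, htop, compl_top]
        map_himp' := fun a b => (himp a b).symm }
    have hf : B.eval (fun i => f (ν i)) = ⊤ := by rw [← Formula.map_eval, hBν, map_top]
    rw [← hf]
    refine Formula.eval_congr B fun i hi => ?_
    have hin : i < n := Finset.mem_range.1 (hB hi)
    change _ = iicHom D (v (e (ν i)))
    have := hν (e.symm ⟨i, hin⟩)
    rw [e.apply_symm_apply] at this
    rw [this, e.apply_symm_apply]

theorem IsJankovFormula.isCharFormula {χ : Formula} (h : IsJankovFormula χ) :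
    IsCharFormula ∅ χ := by
  obtain ⟨H, _, n, e, a, hSI, ha, rfl⟩ := h
  obtain ⟨ν, hν⟩ : ∃ ν : ℕ → H, ∀ b, ν (e b) = b :=
    ⟨fun i => if h : i < n then e.symm ⟨i, h⟩ else ⊤, fun b => by simp⟩
  refine ⟨H, _, Finset.range n, _, _, _, fun A hA => hA.elim, hSI, defines_diagram e hν, ?_, ?_,
    rfl⟩
  · simp [Formula.vars]
  · rwa [Formula.eval, hν]

end IntermediateLogic

open IntermediateLogic in
theorem theorem6p8 :
    -- the variety `KG` and its subvarieties contain no infinite finitely presentable s.i. algebras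
    (∀ V : Set Formula, kgAxiom ∈ Logic V →
      ∀ (H : Type) [HeytingAlgebra H],
        Mem V H → IsSI H → FinitelyPresentable V H → Finite H) ∧
    -- `Z + Z₇ + Z₂` belongs to the variety `KG` and has a pre-true formula
    Valid KGAlgebra kgAxiom ∧
    (∃ F : Formula, PreTrue F KGAlgebra) ∧
    -- every such formula defines a subvariety of `KG` whose logic is intermediate and is neither
    -- axiomatizable by Jankov formulas nor by characteristic formulas
    ∀ F : Formula, PreTrue F KGAlgebra →
      IsIntermediateLogic (Logic {kgAxiom, F}) ∧
      ¬ JankovAxiomatizable (Logic {kgAxiom, F}) ∧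
      ¬ CharAxiomatizable (Logic {kgAxiom, F}) ∧
      -- relative to any variety `U` with `Z + Z₇ + Z₂ ∈ U`, for characteristic formulas over
      -- arbitrary varieties that contain `Z + Z₇ + Z₂`
      ∀ U G : Set Formula, Mem U KGAlgebra →
        (∀ χ ∈ G, ∃ V : Set Formula, Mem V KGAlgebra ∧ IsCharFormula V χ) →
        Logic (U ∪ G) ≠ Logic {kgAxiom, F} := by
  refine ⟨fun V hV H _ hH hSI hfp => finite_of_finitelyPresentable hV hH hSI hfp, valid_kgAxiom,
    ⟨_, preTrue_kgPreTrue⟩, fun F hF => ?_⟩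
  have hFL : F ∈ Logic {kgAxiom, F} := subset_Logic _ (Set.mem_insert_of_mem _ rfl)
  have relative : ∀ U G : Set Formula, Mem U KGAlgebra →
      (∀ χ ∈ G, ∃ V : Set Formula, Mem V KGAlgebra ∧ IsCharFormula V χ) →
      Logic (U ∪ G) ≠ Logic {kgAxiom, F} := by
    intro U G hU hG h
    refine hF.not_valid (Mem_Logic (V := U ∪ G) ?_ F (h ▸ hFL))
    rintro χ (hχ | hχ)
    · exact hU χ hχ
    · obtain ⟨V, hV, hVχ⟩ := hG χ hχ
      exact hVχ.valid_of_preTrue valid_kgAxiom hF hV (h ▸ subset_Logic _ (Or.inr hχ))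
  refine ⟨isIntermediateLogic_Logic ?_, ?_, fun h => ?_, relative⟩
  · rintro A (rfl | rfl)
    · exact valid_kgAxiom.of_injective (boolHom KGAlgebra) (boolHom_injective KGAlgebra)
    · exact hF.valid_of_injective (boolHom KGAlgebra) (boolHom_injective KGAlgebra)
  · rintro ⟨G, hG, h⟩
    refine relative ∅ G (fun A hA => hA.elim) (fun χ hχ => ⟨∅, fun A hA => hA.elim,
      (hG χ hχ).isCharFormula⟩) ?_
    rw [Set.empty_union, h]
  · exact hF.not_valid (Mem.of_charAxiomatizable valid_kgAxiom hF h subset_rfl F hFL)
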